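/- **Setting.** Let $H=\sum_{i=1}^m v_iP_i$ be a signed Pauli Hamiltonian on $n$ qubits, $v_i\in\{\pm1\}$, $P_i\in\{I,X,Y,Z\}^{\otimes n}$, and suppose that $[P_i,P_j]=0$ for all $i,j$. The symplectic vector $\mathrm{symp}(P)\in\mathbb F_2^{2n}$ of a Pauli string $P$ has, for each qubit $j$, $h_j=1$ iff the $j$-th factor is $X$ or $Y$, and $h_{n+j}=1$ iff it is $Z$ or $Y$. The symplectic code $\mathrm{Symp}(H)$ is the binary linear code with parity check matrix $B^{\mathsf T}\in\mathbb F_2^{2n\times m}$ whose $i$-th column is $\mathrm{symp}(P_i)$. A weight-$\ell$ decoding oracle for $H$ is a unitary $\mathcal D_H^{(\ell)}$ on $m+2n$ qubits with $\mathcal D_H^{(\ell)}|\mathbf y\rangle|B^{\mathsf T}\mathbf y\rangle=|0\rangle|B^{\mathsf T}\mathbf y\rangle$ for every $\mathbf y\in\mathbb F_2^m$ of Hamming weight $|\mathbf y|\le\ell$. Let $|\Phi^n\rangle=2^{-n/2}\sum_{\mathbf x\in\mathbb F_2^n}|\mathbf x\rangle|\mathbf x\rangle$. **Algorithm (HDQI,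 commuting case).** The input is $n,m,\ell$, $(v_i,P_i)_i$ and the coefficients of a real polynomial $\mathcal P$ with $\deg\mathcal P\le\ell$. All qubits start in $|0\rangle$. 1. Compute $w_0,\dots,w_\ell\in\mathbb R$ with $\mathcal P(\sum_i z_i)=\sum_{j=0}^{\ell}w_j\sum_{|\mathbf y|=j}z_1^{y_1}\cdots z_m^{y_m}$ for commuting variables with $z_i^2=1$. 2. Prepare the pilot state $\mathcal N^{-1}\sum_{j=0}^\ell w_j\sum_{|\mathbf y|=j}|\mathbf y\rangle$ in an $m$-qubit register $A$, where $\mathcal N^2=\sum_{j=0}^{\ell} w_j^2\binom mj$ (a weighted superposition of Dicke states), and $|\Phi^n\rangle$ in two $n$-qubit registers $B,C$. 3. Apply $\bigotimes_iZ_i^{(1-v_i)/2}$ to $A$, and then $\prod_iC^{(i)}P_i$, where $C^{(i)}P_i$ is $P_i$ on $B$ controlled by the $i$-th qubit of $A$. 4. Apply the coherent Bell measurement to $BC$: Hadamard and controlled-NOT gates that map $(P\otimes I)|\Phi^n\rangle$ to $|\mathrm{symp}(P)\rangle$, up to a phase, for every Pauli string $P$. 5. Apply $\mathcal D_H^{(\ell)}$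 to $A$ and $BC$, and then the inverse of step 4 to $BC$. 6. Output register $B$. **Machine model.** The algorithm is one fixed program for all inputs. It runs on a random access machine with counters and real arrays (exact real arithmetic, including square roots) which applies the quantum gates one after the other. Each classical operation takes one step, and so does each gate (a one-qubit Pauli, Hadamard or real rotation, with at most two control qubits) and each oracle call. **Theorem.** The pilot state can be prepared in this model, so that the following holds. If $m\le q(n)$ for a polynomial $q$, then there is a polynomial $r$, depending only on $q$, such that for all commuting $H$ as above, all $\ell\le m$, and all nonzero real polynomials $\mathcal P$ with $\deg\mathcal P\le\ell$, the algorithm, including the preparation of the pilot state, takes at most $r(n)$ steps, uses at most $r(n)$ ancilla qubits, and calls the oracle exactly once. For every weight-$\ell$ decoding oracle $\mathcal D_H^{(\ell)}$ for $H$, the reduced state of register $B$ at the end is exactly $$\rho_{\mathcal P}(H)=\frac{\mathcal P^2(H)}{\mathrm{Tr}[\mathcal P^2(H)]}.$$ -/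

import Mathlib

namespace HDQI

/-! ### Paulis, Hamiltonians, and the target state -/

/-- The four one-qubit Pauli labels. -/
inductive Pauli where
  | I
  | X
  | Y
  | Z

/-- The one-qubit Pauli matrices; the entry at `(r, c)` is `⟨r| σ |c⟩`. -/
noncomputable def Pauli.mat : Pauli → Matrix (ZMod 2) (ZMod 2) ℂ
  | .I => 1
  | .X => Matrix.of fun r c => if r = c then 0 else 1
  | .Y => Matrix.of fun r c => if r = c then 0 else if r = 1 then Complex.I else -Complex.I
  | .Z => Matrix.of fun r c => if r ≠ c then 0 else if r = 1 then -1 else 1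

/-- The `X` bit of the symplectic representation of a one-qubit Pauli. -/
def Pauli.xBit : Pauli → ZMod 2
  | .I => 0
  | .X => 1
  | .Y => 1
  | .Z => 0

/-- The `Z` bit of the symplectic representation of a one-qubit Pauli. -/
def Pauli.zBit : Pauli → ZMod 2
  | .I => 0
  | .X => 0
  | .Y => 1
  | .Z => 1

/-- The numerical code under which a Pauli label is stored in the input of a machine. -/
def Pauli.code : Pauli → ℕ
  | .I => 0
  | .X => 1
  | .Y => 2
  | .Z => 3

/-- The matrix on `n` qubits of the Pauli string `⨂ⱼ P j`. -/
noncomputable def pauliString {n : ℕ} (P : Fin n → Pauli) :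
    Matrix (Fin n → ZMod 2) (Fin n → ZMod 2) ℂ :=
  Matrix.of fun x y => ∏ j, (P j).mat (x j) (y j)

/-- A signed Pauli Hamiltonian `∑ i, v i • P i` with `m` terms on `n` qubits, `v i = ±1`. -/
structure PauliHamiltonian (n m : ℕ) where
  v : Fin m → ℤˣ
  P : Fin m → Fin n → Pauli

namespace PauliHamiltonian

variable {n m : ℕ}

/-- The Hamiltonian as a matrix. -/
noncomputable def mat (H : PauliHamiltonian n m) :
    Matrix (Fin n → ZMod 2) (Fin n → ZMod 2) ℂ :=
  ∑ i, ((H.v i : ℤ) : ℂ) • pauliString (H.P i)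

/-- All terms commute pairwise. -/
def IsCommuting (H : PauliHamiltonian n m) : Prop :=
  ∀ i j, Commute (pauliString (H.P i)) (pauliString (H.P j))

/-- The parity check matrix `Bᵀ` of the symplectic code `Symp(H)`: its `i`-th column is the
symplectic vector of `P i`, the `X` bits (rows `inl j`) followed by the `Z` bits (rows `inr j`). -/
def checkMatrix (H : PauliHamiltonian n m) : Matrix (Fin n ⊕ Fin n) (Fin m) (ZMod 2) :=
  Matrix.of fun r i => Sum.elim (fun j => (H.P i j).xBit) (fun j => (H.P i j).zBit) r

/-- The polynomial Hamiltonian state `𝒫(H)² / Tr[𝒫(H)²]`. -/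
noncomputable def polyState (H : PauliHamiltonian n m) (p : Polynomial ℝ) :
    Matrix (Fin n → ZMod 2) (Fin n → ZMod 2) ℂ :=
  ((Polynomial.aeval H.mat p ^ 2).trace)⁻¹ • Polynomial.aeval H.mat p ^ 2

/-- `D` is a weight-`l` decoding oracle for `H`: a unitary on `m + 2n` qubits such that
`D |y⟩|Bᵀ y⟩ = |0⟩|Bᵀ y⟩` for every `y` of Hamming weight at most `l`. -/
def IsDecodingOracle (H : PauliHamiltonian n m) (l : ℕ)
    (D : Matrix ((Fin m → ZMod 2) × (Fin n ⊕ Fin n → ZMod 2))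
      ((Fin m → ZMod 2) × (Fin n ⊕ Fin n → ZMod 2)) ℂ) : Prop :=
  D ∈ Matrix.unitaryGroup ((Fin m → ZMod 2) × (Fin n ⊕ Fin n → ZMod 2)) ℂ ∧
    ∀ y : Fin m → ZMod 2, hammingNorm y ≤ l →
      D.mulVec (Pi.single (y, H.checkMatrix.mulVec y) 1) =
        Pi.single (0, H.checkMatrix.mulVec y) 1

end PauliHamiltonian

/-! ### Quantum circuits -/

/-- One-qubit operations. `rot a b` is the real rotation whose first column is the unit vector
in the direction of `(a, b)`. `R` is the type of the parameters. -/
inductive OneQubit (R : Type) where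
  | X
  | Y
  | Z
  | H
  | rot (a b : R)

/-- The unitary matrix of a one-qubit operation. -/
noncomputable def OneQubit.mat : OneQubit ℝ → Matrix (ZMod 2) (ZMod 2) ℂ
  | .X => Pauli.X.mat
  | .Y => Pauli.Y.mat
  | .Z => Pauli.Z.mat
  | .H => Matrix.of fun r c => (if r = 1 ∧ c = 1 then -1 else 1) / ((√2 : ℝ) : ℂ)
  | .rot a b =>
      if a = 0 ∧ b = 0 then 1
      else Matrix.of fun r c =>
        (((if r = c then a else if r = 1 then b else -b) / √(a ^ 2 + b ^ 2) : ℝ) : ℂ)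

/-- Elementary gates on the wires `W`: a one-qubit operation on a target wire `t` with at most
two control wires. -/
inductive Gate (W R : Type) where
  | single (u : OneQubit R) (t : W)
  | ctrl (c : W) (u : OneQubit R) (t : W)
  | ctrl₂ (c₁ c₂ : W) (u : OneQubit R) (t : W)

/-- One step of a quantum circuit: an elementary gate, or a call to the decoding oracle. -/
inductive QStep (W R : Type) where
  | gate (g : Gate W R)
  | oracle

/-- Relabelling of the parameters. -/
def OneQubit.map {R R₂ : Type} (f : R → R₂) : OneQubit R → OneQubit R₂
  | .X => .X
  | .Y => .Y
  | .Z => .Z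
  | .H => .H
  | .rot a b => .rot (f a) (f b)

/-- Relabelling of the wires and of the parameters. -/
def Gate.map {W W₂ R R₂ : Type} (f : W → W₂) (g : R → R₂) : Gate W R → Gate W₂ R₂
  | .single u t => .single (u.map g) (f t)
  | .ctrl c u t => .ctrl (f c) (u.map g) (f t)
  | .ctrl₂ c₁ c₂ u t => .ctrl₂ (f c₁) (f c₂) (u.map g) (f t)

/-- Relabelling of the wires and of the parameters. -/
def QStep.map {W W₂ R R₂ : Type} (f : W → W₂) (g : R → R₂) : QStep W R → QStep W₂ R₂
  | .gate a => .gate (a.map f g)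
  | .oracle => .oracle

/-- The controlled-NOT gate. -/
def Gate.cx {W R : Type} (c t : W) : Gate W R := .ctrl c .X t

/-- State vectors on the qubits `W`, in the computational basis. -/
abbrev QState (W : Type) : Type := (W → ZMod 2) → ℂ

/-- Apply the one-qubit matrix `u` to the wire `t`, controlled on all wires of the list `cs`
being `1`. If the target is one of the controls the gate does nothing. -/
noncomputable def applyCtrl {W : Type} [DecidableEq W] (cs : List W)
    (u : Matrix (ZMod 2) (ZMod 2) ℂ) (t : W) (ψ : QState W) : QState W :=
  fun x =>
    if t ∉ cs ∧ ∀ c ∈ cs, x c = 1 then ∑ b : ZMod 2, u (x t) b * ψ (Function.update x t b)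
    else ψ x

/-- The action of an elementary gate. -/
noncomputable def Gate.apply {W : Type} [DecidableEq W] : Gate W ℝ → QState W → QState W
  | .single u t => applyCtrl [] u.mat t
  | .ctrl c u t => applyCtrl [c] u.mat t
  | .ctrl₂ c₁ c₂ u t => applyCtrl [c₁, c₂] u.mat t

/-- The action of an oracle-free circuit; the head of the list is applied first. -/
noncomputable def applyGates {W : Type} [DecidableEq W] (gs : List (Gate W ℝ)) (ψ : QState W) :
    QState W :=
  gs.foldl (fun φ g => g.apply φ) ψ

/-- The state with all qubits `0`. -/
def zeroState (W : Type) [Fintype W] [DecidableEq W] : QState W :=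
  Pi.single 0 1

/-- The wires: register `A` (`m` qubits), registers `B` and `C` (`n` qubits each), and `a`
ancilla qubits. -/
abbrev Wire (n m a : ℕ) : Type := Fin m ⊕ (Fin n ⊕ Fin n) ⊕ Fin a

namespace Wire

variable {n m a : ℕ}

/-- The `i`-th qubit of register `A`. -/
def A (i : Fin m) : Wire n m a := Sum.inl i

/-- The `j`-th qubit of register `B`. -/
def B (j : Fin n) : Wire n m a := Sum.inr (Sum.inl (Sum.inl j))

/-- The `j`-th qubit of register `C`. -/
def C (j : Fin n) : Wire n m a := Sum.inr (Sum.inl (Sum.inr j))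

/-- The `k`-th ancilla qubit. -/
def anc (k : Fin a) : Wire n m a := Sum.inr (Sum.inr k)

/-- The bit string with content `y` in register `A`, `s` in the registers `BC`, and `w` in the
ancilla register. -/
def bits (y : Fin m → ZMod 2) (s : Fin n ⊕ Fin n → ZMod 2) (w : Fin a → ZMod 2) :
    Wire n m a → ZMod 2 :=
  Sum.elim y (Sum.elim s w)

end Wire

section Circuits

variable {n m a : ℕ}

/-- The action of the oracle on the registers `A` and `BC`. -/
noncomputable def applyOracle
    (D : Matrix ((Fin m → ZMod 2) × (Fin n ⊕ Fin n → ZMod 2))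
      ((Fin m → ZMod 2) × (Fin n ⊕ Fin n → ZMod 2)) ℂ)
    (ψ : QState (Wire n m a)) : QState (Wire n m a) :=
  fun x => ∑ ys : (Fin m → ZMod 2) × (Fin n ⊕ Fin n → ZMod 2),
    D (fun i => x (Sum.inl i), fun r => x (Sum.inr (Sum.inl r))) ys *
      ψ (Wire.bits ys.1 ys.2 fun k => x (Sum.inr (Sum.inr k)))

/-- The action of one circuit step, the oracle being `D`. -/
noncomputable def QStep.apply
    (D : Matrix ((Fin m → ZMod 2) × (Fin n ⊕ Fin n → ZMod 2))
      ((Fin m → ZMod 2) × (Fin n ⊕ Fin n → ZMod 2)) ℂ) :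
    QStep (Wire n m a) ℝ → QState (Wire n m a) → QState (Wire n m a)
  | .gate g => g.apply
  | .oracle => applyOracle D

/-- The action of a circuit with oracle `D`; the head of the list is applied first. -/
noncomputable def applySteps
    (D : Matrix ((Fin m → ZMod 2) × (Fin n ⊕ Fin n → ZMod 2))
      ((Fin m → ZMod 2) × (Fin n ⊕ Fin n → ZMod 2)) ℂ)
    (cs : List (QStep (Wire n m a) ℝ)) (ψ : QState (Wire n m a)) : QState (Wire n m a) :=
  cs.foldl (fun φ c => c.apply D φ) ψ

/-- The reduced density matrix of register `B` of a pure state. -/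
noncomputable def reducedB (ψ : QState (Wire n m a)) :
    Matrix (Fin n → ZMod 2) (Fin n → ZMod 2) ℂ :=
  Matrix.of fun b b₂ =>
    ∑ y : Fin m → ZMod 2, ∑ c : Fin n → ZMod 2, ∑ w : Fin a → ZMod 2,
      ψ (Wire.bits y (Sum.elim b c) w) * star (ψ (Wire.bits y (Sum.elim b₂ c) w))

/-- The number of oracle calls of a circuit. -/
def oracleCalls {W R : Type} (cs : List (QStep W R)) : ℕ :=
  cs.countP fun c => match c with
    | .gate _ => false
    | .oracle => true

/-! ### The algorithm -/

/-- `w 0, …, w l` are the coefficients of the expansion of `p (z₁ + ⋯ + z_m)` into elementary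
symmetric polynomials in commuting variables with `zᵢ² = 1`. -/
def IsSymmetricExpansion (m l : ℕ) (p : Polynomial ℝ) (w : ℕ → ℝ) : Prop :=
  ∀ (R : Type) [CommRing R] [Algebra ℝ R] (z : Fin m → R), (∀ i, z i ^ 2 = 1) →
    Polynomial.aeval (∑ i, z i) p =
      ∑ j ∈ Finset.range (l + 1),
        w j • ∑ y : Fin m → ZMod 2 with hammingNorm y = j, ∏ i, z i ^ (y i).val

/-- The pilot state on register `A`, all other qubits being `0`: the weighted superposition of
Dicke states `𝒩⁻¹ ∑_{j ≤ l} w j ∑_{|y| = j} |y⟩` with `𝒩² = ∑_{j ≤ l} (w j)² (m choose j)`. -/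
noncomputable def pilotState (n m a l : ℕ) (w : ℕ → ℝ) : QState (Wire n m a) :=
  (((√(∑ j ∈ Finset.range (l + 1), w j ^ 2 * (m.choose j : ℝ)))⁻¹ : ℝ) : ℂ) •
    ∑ j ∈ Finset.range (l + 1), (w j : ℂ) •
      ∑ y : Fin m → ZMod 2 with hammingNorm y = j, Pi.single (Wire.bits y 0 0) 1

/-- Preparation of the maximally entangled state `|Φⁿ⟩` on the registers `BC`. -/
def bellPreparation : List (Gate (Wire n m a) ℝ) :=
  (List.finRange n).flatMap fun j => [.single .H (.B j), .cx (.B j) (.C j)]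

/-- `⨂ᵢ Zᵢ ^ ((1 - vᵢ) / 2)` on register `A`. -/
def signPhases (H : PauliHamiltonian n m) : List (Gate (Wire n m a) ℝ) :=
  (List.finRange m).flatMap fun i => if H.v i = -1 then [.single .Z (.A i)] else []

/-- The Pauli `σ` on the `j`-th qubit of `B`, controlled by the `i`-th qubit of `A`. -/
def controlledPauli (i : Fin m) (j : Fin n) : Pauli → List (Gate (Wire n m a) ℝ)
  | .I => []
  | .X => [.ctrl (.A i) .X (.B j)]
  | .Y => [.ctrl (.A i) .Y (.B j)]
  | .Z => [.ctrl (.A i) .Z (.B j)]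

/-- `∏ᵢ C⁽ⁱ⁾ Pᵢ` from register `A` to register `B`, qubit by qubit. -/
def controlledPaulis (H : PauliHamiltonian n m) : List (Gate (Wire n m a) ℝ) :=
  (List.finRange m).flatMap fun i =>
    (List.finRange n).flatMap fun j => controlledPauli i j (H.P i j)

/-- The coherent Bell measurement on `BC`: the inverse of the Bell preparation, followed by the
exchange of `B` and `C` (three controlled-NOTs per pair). It sends `(P ⊗ 1)|Φⁿ⟩` to
`|symp P⟩`, up to a phase depending on `P` that the inverse circuit restores. -/
def bellMeasurement : List (Gate (Wire n m a) ℝ) :=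
  (List.finRange n).flatMap fun j =>
    [.cx (.B j) (.C j), .single .H (.B j),
      .cx (.B j) (.C j), .cx (.C j) (.B j), .cx (.B j) (.C j)]

/-- Hamiltonian decoded quantum interferometry for `H`, starting from a circuit `pilot` that
prepares the pilot state. All gates of the Bell measurement are their own inverses, so that its
inverse is the reversed circuit. -/
def hdqiCircuit (H : PauliHamiltonian n m) (pilot : List (Gate (Wire n m a) ℝ)) :
    List (QStep (Wire n m a) ℝ) :=
  (pilot ++ bellPreparation ++ signPhases H ++ controlledPaulis H ++ bellMeasurement).map .gate
    ++ [.oracle] ++ bellMeasurement.reverse.map .gate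

end Circuits

/-! ### The machine model

A program runs on a random access machine with finitely many counters (natural numbers) and
finitely many two-dimensional arrays of real numbers (exact arithmetic), which applies quantum
gates one after the other. Every elementary operation, every gate, and every oracle call takes
one step. -/

/-- The four quantum registers. -/
inductive Register where
  | A
  | B
  | C
  | anc

/-- The qubit address of a wire. -/
def Wire.address {n m a : ℕ} : Wire n m a → Register × ℕ
  | .inl i => (.A, i)
  | .inr (.inl (.inl j)) => (.B, j)
  | .inr (.inl (.inr j)) => (.C, j)
  | .inr (.inr k) => (.anc, k)

/-- A reference to a real memory cell: an array name and two counters holding the indices. -/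
structure Cell where
  array : ℕ
  row : ℕ
  col : ℕ

/-- Programs. Counters are named by natural numbers. -/
inductive Program where
  /-- Counter `x` becomes the constant `k`. -/
  | set (x k : ℕ)
  /-- Counter `x` becomes the sum of the counters `y` and `z`. -/
  | add (x y z : ℕ)
  /-- Counter `x` becomes the truncated difference of the counters `y` and `z`. -/
  | sub (x y z : ℕ)
  /-- Counter `x` becomes `1` if the sign `v i` is `-1` and `0` otherwise, `i` in counter `y`. -/
  | readSign (x y : ℕ)
  /-- Counter `x` becomes the code of the `j`-th factor of `P i`, `i` in `y` and `j` in `z`. -/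
  | readPauli (x y z : ℕ)
  /-- A real cell becomes the `k`-th input coefficient, `k` in counter `y`. -/
  | readCoeff (d : Cell) (y : ℕ)
  /-- A real cell becomes the value of the counter `y`. -/
  | cast (d : Cell) (y : ℕ)
  | radd (d e f : Cell)
  | rsub (d e f : Cell)
  | rmul (d e f : Cell)
  | rdiv (d e f : Cell)
  | rsqrt (d e : Cell)
  /-- Apply a quantum gate, or call the oracle. The position of a qubit within its register is
  the value of a counter, and the parameters of a rotation are the values of real cells. -/
  | quantum (c : QStep (Register × ℕ) Cell)
  | seq (p q : Program)
  /-- Run `p` if counter `x` is zero, and `q` otherwise. -/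
  | ifZero (x : ℕ) (p q : Program)
  /-- Run `p` if the real cell is positive, and `q` otherwise. -/
  | ifPos (d : Cell) (p q : Program)
  /-- Run `p` with counter `x` equal to `0, 1, …, N - 1`, with `N` the value of counter `y` at
  the start of the loop. -/
  | loop (x y : ℕ) (p : Program)

/-- The input of a machine. -/
structure Input where
  n : ℕ
  m : ℕ
  l : ℕ
  sign : ℕ → ℕ
  pauli : ℕ → ℕ → ℕ
  coeff : ℕ → ℝ

/-- The input describing a Hamiltonian, a degree bound `l`, and the coefficients of a
polynomial. -/
noncomputable def Input.of {n m : ℕ} (H : PauliHamiltonian n m) (l : ℕ) (p : Polynomial ℝ) :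
    Input where
  n := n
  m := m
  l := l
  sign i := if h : i < m then (if H.v ⟨i, h⟩ = -1 then 1 else 0) else 0
  pauli i j := if h : i < m ∧ j < n then (H.P ⟨i, h.1⟩ ⟨j, h.2⟩).code else 0
  coeff k := p.coeff k

/-- The configuration of a machine: counters, real arrays, the quantum steps applied so far, and
the number of elapsed steps. -/
structure Config where
  ctr : ℕ → ℕ
  mem : ℕ → ℕ → ℕ → ℝ
  circuit : List (QStep (Register × ℕ) ℝ)
  time : ℕ

namespace Config

/-- Let one unit of time pass. -/
def tick (s : Config) : Config := { s with time := s.time + 1 }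

/-- Write a counter. -/
def setCtr (s : Config) (x k : ℕ) : Config := { s with ctr := Function.update s.ctr x k }

/-- Read a real cell. -/
def get (s : Config) (d : Cell) : ℝ := s.mem d.array (s.ctr d.row) (s.ctr d.col)

/-- Write a real cell. -/
noncomputable def put (s : Config) (d : Cell) (r : ℝ) : Config :=
  { s with mem := fun k i j =>
      if k = d.array ∧ i = s.ctr d.row ∧ j = s.ctr d.col then r else s.mem k i j }

end Config

/-- The configuration after the execution of a program on a given input. -/
noncomputable def Program.exec (inp : Input) : Program → Config → Config
  | .set x k, s => (s.setCtr x k).tick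
  | .add x y z, s => (s.setCtr x (s.ctr y + s.ctr z)).tick
  | .sub x y z, s => (s.setCtr x (s.ctr y - s.ctr z)).tick
  | .readSign x y, s => (s.setCtr x (inp.sign (s.ctr y))).tick
  | .readPauli x y z, s => (s.setCtr x (inp.pauli (s.ctr y) (s.ctr z))).tick
  | .readCoeff d y, s => (s.put d (inp.coeff (s.ctr y))).tick
  | .cast d y, s => (s.put d (s.ctr y : ℝ)).tick
  | .radd d e f, s => (s.put d (s.get e + s.get f)).tick
  | .rsub d e f, s => (s.put d (s.get e - s.get f)).tick
  | .rmul d e f, s => (s.put d (s.get e * s.get f)).tick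
  | .rdiv d e f, s => (s.put d (s.get e / s.get f)).tick
  | .rsqrt d e, s => (s.put d √(s.get e)).tick
  | .quantum c, s =>
      { s with circuit := s.circuit ++ [c.map (fun q : Register × ℕ => (q.1, s.ctr q.2)) s.get] }.tick
  | .seq p q, s => q.exec inp (p.exec inp s)
  | .ifZero x p q, s => if s.ctr x = 0 then p.exec inp s.tick else q.exec inp s.tick
  | .ifPos d p q, s =>
      open Classical in if 0 < s.get d then p.exec inp s.tick else q.exec inp s.tick
  | .loop x y p, s =>
      (List.range (s.ctr y)).foldl (fun t i => p.exec inp (t.setCtr x i).tick) s.tick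

/-- Run a program from the start: the counters `0, 1, 2` hold `n`, `m`, `l`, all other counters
and all real cells are zero, and no gate has been applied. -/
noncomputable def Program.run (p : Program) (inp : Input) : Config :=
  p.exec inp
    { ctr := fun x => if x = 0 then inp.n else if x = 1 then inp.m else if x = 2 then inp.l else 0
      mem := fun _ _ _ => 0
      circuit := []
      time := 0 }

end HDQI

namespace HDQI

/-! ### Linearity of circuits -/

/-! Write `P^y` for the product of those `P_i` with `y_i = 1`, `v^y` for the product of their signs,
and `β_y = w_{|y|}` for `|y| ≤ l`, `β_y = 0` otherwise. The `v_i P_i` commute and square to `1`, so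
the symmetric expansion gives `𝒫(H) = ∑_y β_y v^y P^y` (`PauliHamiltonian.aeval_mat`). The circuit
builds exactly this sum. After the controlled Paulis the state is proportional to `∑_y β_y v^y |y⟩
(P^y ⊗ 1)|Φ⟩`. Up to a phase, `P^y` is determined by its symplectic vector `Bᵀy`, so the Bell
measurement turns the second factor into a phase times `|Bᵀy⟩`. The oracle erases `y`, and the
inverse Bell measurement restores the same phase together with `(P^y ⊗ 1)|Φ⟩`. What remains is `|0⟩
(𝒫(H) ⊗ 1)|Φ⟩ / 𝒩`, whose reduction to `B` is `𝒫(H)² / (2ⁿ 𝒩²)`.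

The normalization comes from the oracle as well: a unitary with the required action exists only if
strings of weight at most `l` have distinct syndromes. The corresponding `P^y` are then
Hilbert–Schmidt orthogonal, and `Tr 𝒫(H)² = 2ⁿ 𝒩²` (`PauliHamiltonian.trace_aeval_sq`,
`reducedB_hdqiCircuit`).

The weights `w_j` come from Horner's scheme in the basis of elementary symmetric polynomials: for
`z_i² = 1`, multiplication by `∑ z_i` is a three-term recurrence in the degree
(`sum_mul_sum_hammingNorm`). The pilot state depends on `y` only through `|y|`, so it can be
prepared qubit by qubit. A one-hot counter holds the number of ones so far, each qubit is rotated in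
the ratio of the norms of the two remaining branches, and the counter is uncomputed at the end
(`applyGates_pilotCircuit`).

Finally a fixed program is shown to compute both tables and to emit this circuit, by a loop rule
that tracks counters, memory, emitted gates and elapsed time together (`Reaches.loop`,
`hdqiProgram_run`). -/

theorem sum_zmod_two {M : Type*} [AddCommMonoid M] (f : ZMod 2 → M) : ∑ b, f b = f 0 + f 1 :=
  Fin.sum_univ_two f

theorem zmod_two_cases (b : ZMod 2) : b = 0 ∨ b = 1 := by
  revert b; decide

theorem isLinearMap_applyCtrl {W : Type} [DecidableEq W] (cs : List W)
    (u : Matrix (ZMod 2) (ZMod 2) ℂ) (t : W) : IsLinearMap ℂ (applyCtrl cs u t) where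
  map_add φ ψ := by
    funext x
    simp only [applyCtrl, Pi.add_apply]
    split_ifs
    · simp only [mul_add, Finset.sum_add_distrib]
    · rfl
  map_smul c ψ := by
    funext x
    simp only [applyCtrl, Pi.smul_apply, smul_eq_mul]
    split_ifs
    · rw [Finset.mul_sum]
      exact Finset.sum_congr rfl fun b _ => by ring
    · rfl

theorem Gate.isLinearMap_apply {W : Type} [DecidableEq W] (g : Gate W ℝ) :
    IsLinearMap ℂ g.apply := by
  cases g <;> exact isLinearMap_applyCtrl _ _ _

theorem isLinearMap_applyOracle {n m a : ℕ}
    (D : Matrix ((Fin m → ZMod 2) × (Fin n ⊕ Fin n → ZMod 2))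
      ((Fin m → ZMod 2) × (Fin n ⊕ Fin n → ZMod 2)) ℂ) :
    IsLinearMap ℂ (applyOracle (a := a) D) where
  map_add φ ψ := by
    funext x
    simp only [applyOracle, Pi.add_apply, mul_add, Finset.sum_add_distrib]
  map_smul c ψ := by
    funext x
    simp only [applyOracle, Pi.smul_apply, smul_eq_mul]
    rw [Finset.mul_sum]
    exact Finset.sum_congr rfl fun b _ => by ring

section

variable {W : Type} [DecidableEq W]

@[simp] theorem applyGates_nil (ψ : QState W) : applyGates [] ψ = ψ := rfl

@[simp] theorem applyGates_cons (g : Gate W ℝ) (gs : List (Gate W ℝ)) (ψ : QState W) :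
    applyGates (g :: gs) ψ = applyGates gs (g.apply ψ) := rfl

theorem applyGates_append (gs hs : List (Gate W ℝ)) (ψ : QState W) :
    applyGates (gs ++ hs) ψ = applyGates hs (applyGates gs ψ) := by
  simp [applyGates]

theorem isLinearMap_applyGates (gs : List (Gate W ℝ)) : IsLinearMap ℂ (applyGates gs) := by
  induction gs with
  | nil => exact ⟨fun _ _ => rfl, fun _ _ => rfl⟩
  | cons g gs ih =>
    refine ⟨fun φ ψ => ?_, fun c ψ => ?_⟩
    · rw [applyGates_cons, g.isLinearMap_apply.map_add, ih.map_add]; rfl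
    · rw [applyGates_cons, g.isLinearMap_apply.map_smul, ih.map_smul]; rfl

end

theorem IsLinearMap.map_sum_smul {E F ι : Type*} [AddCommGroup E] [Module ℂ E] [AddCommGroup F]
    [Module ℂ F] {f : E → F} (hf : IsLinearMap ℂ f) (s : Finset ι) (c : ι → ℂ) (ψ : ι → E) :
    f (∑ i ∈ s, c i • ψ i) = ∑ i ∈ s, c i • f (ψ i) := by
  have := map_sum (hf.mk' f) (fun i => c i • ψ i) s
  simpa only [map_smul, IsLinearMap.mk'_apply] using this

theorem applySteps_gates {n m a : ℕ}
    (D : Matrix ((Fin m → ZMod 2) × (Fin n ⊕ Fin n → ZMod 2))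
      ((Fin m → ZMod 2) × (Fin n ⊕ Fin n → ZMod 2)) ℂ)
    (gs : List (Gate (Wire n m a) ℝ)) (ψ : QState (Wire n m a)) :
    applySteps D (gs.map .gate) ψ = applyGates gs ψ := by
  simp only [applySteps, applyGates, List.foldl_map]
  rfl

theorem applySteps_hdqiCircuit {n m a : ℕ} (H : PauliHamiltonian n m)
    (D : Matrix ((Fin m → ZMod 2) × (Fin n ⊕ Fin n → ZMod 2))
      ((Fin m → ZMod 2) × (Fin n ⊕ Fin n → ZMod 2)) ℂ)
    (pilot : List (Gate (Wire n m a) ℝ)) (ψ : QState (Wire n m a)) :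
    applySteps D (hdqiCircuit H pilot) ψ =
      applyGates bellMeasurement.reverse (applyOracle D (applyGates bellMeasurement
        (applyGates (controlledPaulis H) (applyGates (signPhases H)
          (applyGates bellPreparation (applyGates pilot ψ)))))) := by
  have happ : ∀ (cs ds : List (QStep (Wire n m a) ℝ)) (φ : QState (Wire n m a)),
      applySteps D (cs ++ ds) φ = applySteps D ds (applySteps D cs φ) := by
    intro cs ds φ
    simp [applySteps]
  rw [hdqiCircuit, happ, happ, applySteps_gates, applySteps_gates]
  simp only [applyGates_append]
  rfl

theorem oracleCalls_hdqiCircuit {n m a : ℕ} (H : PauliHamiltonian n m)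
    (pilot : List (Gate (Wire n m a) ℝ)) : oracleCalls (hdqiCircuit H pilot) = 1 := by
  have happ : ∀ cs ds : List (QStep (Wire n m a) ℝ),
      oracleCalls (cs ++ ds) = oracleCalls cs + oracleCalls ds := fun cs ds => by
    simp only [oracleCalls, List.countP_append]
  have hgates : ∀ gs : List (Gate (Wire n m a) ℝ), oracleCalls (gs.map QStep.gate) = 0 := by
    intro gs
    rw [oracleCalls, List.countP_map, List.countP_eq_zero]
    simp
  rw [hdqiCircuit, happ, happ, hgates, hgates]
  rfl

/-! ### Product states of the registers `BC` -/

section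

variable {n m a : ℕ}

/-- Content `y` of register `A`, ancillas `0`, and the pair of the `j`-th qubits of `B` and `C`
in the (unnormalized) state with amplitudes `f j`. -/
noncomputable def prodState (y : Fin m → ZMod 2) (f : Fin n → Matrix (ZMod 2) (ZMod 2) ℂ) :
    QState (Wire n m a) :=
  fun x => if (∀ i, x (.A i) = y i) ∧ ∀ k, x (.anc k) = 0 then
    ∏ j, f j (x (.B j)) (x (.C j)) else 0

theorem Wire.ext_bits {x x' : Wire n m a → ZMod 2} (hA : ∀ i, x (.A i) = x' (.A i))
    (hB : ∀ j, x (.B j) = x' (.B j)) (hC : ∀ j, x (.C j) = x' (.C j))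
    (hanc : ∀ k, x (.anc k) = x' (.anc k)) : x = x' := by
  funext w
  rcases w with i | (j | j) | k
  · exact hA i
  · exact hB j
  · exact hC j
  · exact hanc k

/-- The oracle acts on basis states, the other steps on pairs of qubits; this passes between the two
descriptions. -/
theorem prodState_single (y : Fin m → ZMod 2) (s : Fin n ⊕ Fin n → ZMod 2) :
    prodState y (fun j => Matrix.single (s (.inl j)) (s (.inr j)) 1) =
      (Pi.single (Wire.bits y s 0) 1 : QState (Wire n m a)) := by
  funext x
  simp only [prodState, Matrix.single_apply, Pi.single_apply]
  by_cases h : x = Wire.bits y s 0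
  · subst h
    simp [Wire.bits, Wire.A, Wire.B, Wire.C, Wire.anc]
  · rw [if_neg h]
    split_ifs with hy
    · by_contra hne
      rw [← ne_eq, Finset.prod_ne_zero_iff] at hne
      apply h
      refine Wire.ext_bits hy.1 (fun j => ?_) (fun j => ?_) hy.2
      · have := hne j (Finset.mem_univ j)
        simp only [ne_eq, ite_eq_right_iff, one_ne_zero, imp_false, not_not] at this
        exact this.1.symm
      · have := hne j (Finset.mem_univ j)
        simp only [ne_eq, ite_eq_right_iff, one_ne_zero, imp_false, not_not] at this
        exact this.2.symm
    · rfl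

theorem prodState_smul (y : Fin m → ZMod 2) (c : Fin n → ℂ)
    (f : Fin n → Matrix (ZMod 2) (ZMod 2) ℂ) :
    prodState (a := a) y (fun j => c j • f j) = (∏ j, c j) • prodState y f := by
  funext x
  simp only [prodState, Matrix.smul_apply, smul_eq_mul, Pi.smul_apply, Finset.prod_mul_distrib]
  split_ifs <;> simp

@[simp] theorem Wire.A_ne_B (i : Fin m) (j : Fin n) : (A i : Wire n m a) ≠ B j := by simp [A, B]
@[simp] theorem Wire.A_ne_C (i : Fin m) (j : Fin n) : (A i : Wire n m a) ≠ C j := by simp [A, C]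
@[simp] theorem Wire.anc_ne_B (i : Fin a) (j : Fin n) : (anc i : Wire n m a) ≠ B j := by
  simp [anc, B]
@[simp] theorem Wire.anc_ne_C (i : Fin a) (j : Fin n) : (anc i : Wire n m a) ≠ C j := by
  simp [anc, C]
@[simp] theorem Wire.A_ne_anc (i : Fin m) (j : Fin a) : (A i : Wire n m a) ≠ anc j := by
  simp [anc, A]
@[simp] theorem Wire.anc_ne_A (i : Fin m) (j : Fin a) : (anc j : Wire n m a) ≠ A i := by
  simp [anc, A]
@[simp] theorem Wire.B_ne_C (i : Fin n) (j : Fin n) : (B i : Wire n m a) ≠ C j := by simp [B, C]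
@[simp] theorem Wire.C_ne_B (i : Fin n) (j : Fin n) : (C i : Wire n m a) ≠ B j := by simp [B, C]
@[simp] theorem Wire.B_inj {i j : Fin n} : (B i : Wire n m a) = B j ↔ i = j := by simp [B]
@[simp] theorem Wire.C_inj {i j : Fin n} : (C i : Wire n m a) = C j ↔ i = j := by simp [C]
@[simp] theorem Wire.anc_inj {i j : Fin a} : (anc i : Wire n m a) = anc j ↔ i = j := by simp [anc]

/-- The value of a product state after changing the bits of one pair of qubits. -/
theorem prodState_update_apply (y : Fin m → ZMod 2) (f : Fin n → Matrix (ZMod 2) (ZMod 2) ℂ)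
    (j : Fin n) (M : Matrix (ZMod 2) (ZMod 2) ℂ) (x : Wire n m a → ZMod 2) :
    prodState y (Function.update f j M) x =
      if (∀ i, x (.A i) = y i) ∧ ∀ k, x (.anc k) = 0 then
        M (x (.B j)) (x (.C j)) * ∏ i ∈ Finset.univ.erase j, f i (x (.B i)) (x (.C i)) else 0 := by
  rw [prodState, ← Finset.mul_prod_erase _ _ (Finset.mem_univ j), Function.update_self]
  congr 2
  refine Finset.prod_congr rfl fun i hi => ?_
  rw [Function.update_of_ne (Finset.ne_of_mem_erase hi)]

theorem prodState_eq (y : Fin m → ZMod 2) (f : Fin n → Matrix (ZMod 2) (ZMod 2) ℂ)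
    (j : Fin n) (x : Wire n m a → ZMod 2) :
    prodState y f x =
      if (∀ i, x (.A i) = y i) ∧ ∀ k, x (.anc k) = 0 then
        f j (x (.B j)) (x (.C j)) * ∏ i ∈ Finset.univ.erase j, f i (x (.B i)) (x (.C i))
      else 0 := by
  rw [← prodState_update_apply, Function.update_eq_self]

theorem prodState_apply_update_B (y : Fin m → ZMod 2) (f : Fin n → Matrix (ZMod 2) (ZMod 2) ℂ)
    (j : Fin n) (x : Wire n m a → ZMod 2) (b : ZMod 2) :
    prodState y f (Function.update x (.B j) b) =
      if (∀ i, x (.A i) = y i) ∧ ∀ k, x (.anc k) = 0 then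
        f j b (x (.C j)) * ∏ i ∈ Finset.univ.erase j, f i (x (.B i)) (x (.C i)) else 0 := by
  rw [prodState_eq _ _ j]
  simp only [ne_eq, Wire.A_ne_B, Wire.anc_ne_B, not_false_eq_true, Function.update_of_ne,
    Function.update_self, Wire.C_ne_B]
  congr 2
  refine Finset.prod_congr rfl fun i hi => ?_
  rw [Function.update_of_ne (by simpa using Finset.ne_of_mem_erase hi)]

theorem prodState_apply_update_C (y : Fin m → ZMod 2) (f : Fin n → Matrix (ZMod 2) (ZMod 2) ℂ)
    (j : Fin n) (x : Wire n m a → ZMod 2) (c : ZMod 2) :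
    prodState y f (Function.update x (.C j) c) =
      if (∀ i, x (.A i) = y i) ∧ ∀ k, x (.anc k) = 0 then
        f j (x (.B j)) c * ∏ i ∈ Finset.univ.erase j, f i (x (.B i)) (x (.C i)) else 0 := by
  rw [prodState_eq _ _ j]
  simp only [ne_eq, Wire.A_ne_C, Wire.anc_ne_C, not_false_eq_true, Function.update_of_ne,
    Function.update_self, Wire.B_ne_C]
  congr 2
  refine Finset.prod_congr rfl fun i hi => ?_
  rw [Function.update_of_ne (by simpa using Finset.ne_of_mem_erase hi)]

/-- The row index of the matrix `f j` is the qubit of `B` and the column index that of `C`, so a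
gate on `B` is a left multiplication. -/
theorem applyCtrl_nil_B_prodState (u : Matrix (ZMod 2) (ZMod 2) ℂ) (j : Fin n)
    (y : Fin m → ZMod 2) (f : Fin n → Matrix (ZMod 2) (ZMod 2) ℂ) :
    applyCtrl [] u (.B j) (prodState (a := a) y f) =
      prodState y (Function.update f j (u * f j)) := by
  funext x
  rw [prodState_update_apply]
  simp only [applyCtrl, List.not_mem_nil, not_false_eq_true, true_and, false_implies,
    implies_true, if_true, prodState_apply_update_B]
  split_ifs
  · simp only [Matrix.mul_apply, Finset.sum_mul, mul_assoc]
  · simp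

theorem applyCtrl_A_B_prodState (u : Matrix (ZMod 2) (ZMod 2) ℂ) (i : Fin m) (j : Fin n)
    (y : Fin m → ZMod 2) (f : Fin n → Matrix (ZMod 2) (ZMod 2) ℂ) :
    applyCtrl [.A i] u (.B j) (prodState (a := a) y f) =
      prodState y (Function.update f j (if y i = 1 then u * f j else f j)) := by
  by_cases hy : y i = 1
  · rw [if_pos hy, ← applyCtrl_nil_B_prodState]
    funext x
    by_cases hx : ∀ i, x (.A i) = y i
    · simp [applyCtrl, hx, hy, (Wire.A_ne_B _ _).symm]
    · simp [applyCtrl, hx, prodState_apply_update_B]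
      simp [prodState, hx]
  · rw [if_neg hy, Function.update_eq_self]
    funext x
    by_cases hx : ∀ i, x (.A i) = y i
    · simp [applyCtrl, hx, hy]
    · simp [applyCtrl, hx, prodState_apply_update_B]
      simp [prodState, hx]

theorem cx_B_C_prodState (j : Fin n) (y : Fin m → ZMod 2)
    (f : Fin n → Matrix (ZMod 2) (ZMod 2) ℂ) :
    (Gate.cx (.B j) (.C j)).apply (prodState (a := a) y f) =
      prodState y (Function.update f j (Matrix.of fun b c => f j b (c + b))) := by
  funext x
  rw [prodState_update_apply]
  simp only [Gate.cx, Gate.apply, applyCtrl, OneQubit.mat, sum_zmod_two, prodState_apply_update_C]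
  rw [prodState_eq _ _ j x]
  rcases zmod_two_cases (x (.B j)) with h | h <;> rcases zmod_two_cases (x (.C j)) with h' | h' <;>
    simp [h, h', Pauli.mat, CharTwo.add_self_eq_zero]

theorem cx_C_B_prodState (j : Fin n) (y : Fin m → ZMod 2)
    (f : Fin n → Matrix (ZMod 2) (ZMod 2) ℂ) :
    (Gate.cx (.C j) (.B j)).apply (prodState (a := a) y f) =
      prodState y (Function.update f j (Matrix.of fun b c => f j (b + c) c)) := by
  funext x
  rw [prodState_update_apply]
  simp only [Gate.cx, Gate.apply, applyCtrl, OneQubit.mat, sum_zmod_two, prodState_apply_update_B]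
  rw [prodState_eq _ _ j x]
  rcases zmod_two_cases (x (.B j)) with h | h <;> rcases zmod_two_cases (x (.C j)) with h' | h' <;>
    simp [h, h', Pauli.mat, CharTwo.add_self_eq_zero]

theorem Z_A_prodState (i : Fin m) (y : Fin m → ZMod 2)
    (f : Fin n → Matrix (ZMod 2) (ZMod 2) ℂ) :
    (Gate.single .Z (.A i)).apply (prodState (a := a) y f) =
      (if y i = 1 then -1 else 1 : ℂ) • prodState y f := by
  funext x
  have hupd : Function.update x (.A i) (x (.A i)) = x := Function.update_eq_self _ _
  -- The gate is diagonal, and on the support of the product state the bit `x (.A i)` is `y i`.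
  have key : (Gate.single .Z (.A i)).apply (prodState (a := a) y f) x =
      (if x (.A i) = 1 then -1 else 1) * prodState y f x := by
    rcases zmod_two_cases (x (.A i)) with h | h <;> rw [h] at hupd <;>
      simp [Gate.apply, applyCtrl, OneQubit.mat, Pauli.mat, h, hupd]
  rw [key, Pi.smul_apply, smul_eq_mul]
  by_cases hx : ∀ i, x (.A i) = y i
  · rw [hx]
  · simp [prodState, hx]

/-- A circuit that acts separately on the pairs of qubits of `B` and `C`. -/
theorem applyGates_flatMap_prodState {G : Fin n → List (Gate (Wire n m a) ℝ)}
    {T : Fin n → Matrix (ZMod 2) (ZMod 2) ℂ → Matrix (ZMod 2) (ZMod 2) ℂ} {y : Fin m → ZMod 2}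
    (h : ∀ j f, applyGates (G j) (prodState y f) =
      prodState y (Function.update f j (T j (f j))))
    (L : List (Fin n)) (hL : L.Nodup) (hmem : ∀ j, j ∈ L)
    (f : Fin n → Matrix (ZMod 2) (ZMod 2) ℂ) :
    applyGates (L.flatMap G) (prodState y f) = prodState y fun j => T j (f j) := by
  have key : ∀ (L : List (Fin n)) (_ : L.Nodup) (f : Fin n → Matrix (ZMod 2) (ZMod 2) ℂ),
      applyGates (L.flatMap G) (prodState y f) =
        prodState y fun j => if j ∈ L then T j (f j) else f j := by
    intro L
    induction L with
    | nil => intro _ f; simp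
    | cons j L ih =>
      intro hL f
      rw [List.nodup_cons] at hL
      rw [List.flatMap_cons, applyGates_append, h, ih hL.2]
      congr 1
      funext k
      by_cases hk : k = j
      · subst hk; simp [hL.1]
      · simp [hk]
  rw [key L hL]
  simp [hmem]

end

/-! ### The Bell measurement on one pair of qubits -/

/-- The action of the Bell measurement on one pair of qubits. -/
noncomputable def bellMap (M : Matrix (ZMod 2) (ZMod 2) ℂ) : Matrix (ZMod 2) (ZMod 2) ℂ :=
  Matrix.of fun b c => (OneQubit.H.mat * Matrix.of fun b c => M b (c + b)) c b

/-- The action of the inverse Bell measurement on one pair of qubits. -/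
noncomputable def bellUnmap (M : Matrix (ZMod 2) (ZMod 2) ℂ) : Matrix (ZMod 2) (ZMod 2) ℂ :=
  Matrix.of fun b c => (OneQubit.H.mat * Matrix.of fun b c => M c b) b (c + b)

theorem add_add_self_zmod_two (b c : ZMod 2) : c + b + b = c := by
  rw [add_assoc, CharTwo.add_self_eq_zero, add_zero]

theorem sqrt_two_inv_mul_self : ((√2 : ℝ) : ℂ)⁻¹ * ((√2 : ℝ) : ℂ)⁻¹ = 1 / 2 := by
  rw [← mul_inv, ← Complex.ofReal_mul, Real.mul_self_sqrt (by norm_num)]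
  norm_num

theorem hadamard_mul_self : OneQubit.H.mat * OneQubit.H.mat = 1 := by
  have h := sqrt_two_inv_mul_self
  ext r c
  rcases zmod_two_cases r with rfl | rfl <;> rcases zmod_two_cases c with rfl | rfl <;>
    simp [Matrix.mul_apply, sum_zmod_two, OneQubit.mat, div_eq_mul_inv, h]; norm_num

/-- The exchange of the two qubits transposes the matrix; the Hadamard and the controlled-NOT are
involutions. -/
theorem bellUnmap_bellMap (M : Matrix (ZMod 2) (ZMod 2) ℂ) : bellUnmap (bellMap M) = M := by
  have h : (Matrix.of fun b c => bellMap M c b) =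
      OneQubit.H.mat * Matrix.of fun b c => M b (c + b) := rfl
  ext b c
  rw [bellUnmap, h, ← mul_assoc, hadamard_mul_self, one_mul]
  simp [add_add_self_zmod_two]

theorem bellMap_smul (c : ℂ) (M : Matrix (ZMod 2) (ZMod 2) ℂ) :
    bellMap (c • M) = c • bellMap M := by
  ext r s
  simp only [bellMap, Matrix.of_apply, Matrix.mul_apply, sum_zmod_two, Matrix.smul_apply,
    smul_eq_mul]
  ring

/-- The matrix `X ^ a * Z ^ b`. -/
def xzMat (a b : ZMod 2) : Matrix (ZMod 2) (ZMod 2) ℂ :=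
  Matrix.of fun r c => if r = c + a then if b = 1 ∧ c = 1 then -1 else 1 else 0

/-- The amplitudes are those of `∑_c (-1)^{bc} |c + a⟩|c⟩`. The controlled-NOT leaves `a` in the
second qubit and `(-1)^{ab} ∑_r (-1)^{br} |r⟩` in the first, which the Hadamard turns into `|b⟩`;
the exchange yields `|a⟩|b⟩`. Hence the phase `(-1)^{ab}`. -/
theorem bellMap_xzMat (a b : ZMod 2) :
    ∃ φ : ℂ, φ * star φ = 1 ∧
      bellMap (((√2 : ℝ) : ℂ)⁻¹ • xzMat a b) = φ • Matrix.single a b 1 := by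
  have h := sqrt_two_inv_mul_self
  refine ⟨if a = 1 ∧ b = 1 then -1 else 1, by split_ifs <;> simp, ?_⟩
  ext r c
  rw [bellMap_smul]
  have h10 : (1 : ZMod 2) + 1 = 0 := rfl
  rcases zmod_two_cases r with rfl | rfl <;> rcases zmod_two_cases c with rfl | rfl <;>
    rcases zmod_two_cases a with rfl | rfl <;> rcases zmod_two_cases b with rfl | rfl <;>
    simp [bellMap, xzMat, Matrix.mul_apply, sum_zmod_two, OneQubit.mat, div_eq_mul_inv, h10,
      mul_add, h] <;> norm_num

/-- `M` is `X ^ a * Z ^ b` up to a phase. -/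
def IsPauliUpToPhase (M : Matrix (ZMod 2) (ZMod 2) ℂ) (a b : ZMod 2) : Prop :=
  ∃ φ : ℂ, φ * star φ = 1 ∧ M = φ • xzMat a b

theorem isPauliUpToPhase_one : IsPauliUpToPhase 1 0 0 := by
  refine ⟨1, by simp, ?_⟩
  ext r c
  simp [xzMat, Matrix.one_apply]

/-- The phases come from `Z X^a = (-1)^a X^a Z` and `Y = i X Z`. -/
theorem IsPauliUpToPhase.pauli_mul {M : Matrix (ZMod 2) (ZMod 2) ℂ} {a b : ZMod 2}
    (h : IsPauliUpToPhase M a b) (σ : Pauli) :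
    IsPauliUpToPhase (σ.mat * M) (σ.xBit + a) (σ.zBit + b) := by
  obtain ⟨φ, hφ, rfl⟩ := h
  suffices h : ∃ θ : ℂ, θ * star θ = 1 ∧
      σ.mat * xzMat a b = θ • xzMat (σ.xBit + a) (σ.zBit + b) by
    obtain ⟨θ, hθ, h⟩ := h
    refine ⟨φ * θ, ?_, by rw [Matrix.mul_smul, h, smul_smul]⟩
    rw [star_mul']
    linear_combination θ * star θ * hφ + hθ
  have h10 : (1 : ZMod 2) + 1 = 0 := rfl
  refine ⟨match σ with
    | .I => 1
    | .X => 1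
    | .Y => Complex.I * if a = 1 then -1 else 1
    | .Z => if a = 1 then -1 else 1, ?_, ?_⟩
  · cases σ <;> rcases zmod_two_cases a with rfl | rfl <;> simp
  · ext r c
    cases σ <;> rcases zmod_two_cases r with rfl | rfl <;>
      rcases zmod_two_cases c with rfl | rfl <;>
      rcases zmod_two_cases a with rfl | rfl <;> rcases zmod_two_cases b with rfl | rfl <;>
      simp [xzMat, Matrix.mul_apply, Pauli.mat, Pauli.xBit, Pauli.zBit, h10]

theorem IsPauliUpToPhase.bellMap {M : Matrix (ZMod 2) (ZMod 2) ℂ} {a b : ZMod 2}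
    (h : IsPauliUpToPhase M a b) :
    ∃ φ : ℂ, φ * star φ = 1 ∧
      bellMap (((√2 : ℝ) : ℂ)⁻¹ • M) = φ • Matrix.single a b 1 := by
  obtain ⟨φ, hφ, rfl⟩ := h
  obtain ⟨θ, hθ, h⟩ := bellMap_xzMat a b
  refine ⟨φ * θ, ?_, by rw [smul_comm, bellMap_smul, h, smul_smul]⟩
  rw [star_mul']
  linear_combination θ * star θ * hφ + hθ

theorem IsPauliUpToPhase.sum_mul_star {M N : Matrix (ZMod 2) (ZMod 2) ℂ} {a b a' b' : ZMod 2}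
    (hM : IsPauliUpToPhase M a b) (hN : IsPauliUpToPhase N a' b') (h : (a, b) ≠ (a', b')) :
    ∑ r, ∑ c, M r c * star (N r c) = 0 := by
  obtain ⟨φ, -, rfl⟩ := hM
  obtain ⟨θ, -, rfl⟩ := hN
  have h10 : (1 : ZMod 2) + 1 = 0 := rfl
  simp only [sum_zmod_two, Matrix.smul_apply, smul_eq_mul]
  rcases zmod_two_cases a with rfl | rfl <;> rcases zmod_two_cases b with rfl | rfl <;>
    rcases zmod_two_cases a' with rfl | rfl <;> rcases zmod_two_cases b' with rfl | rfl <;>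
    simp_all [xzMat]

theorem IsPauliUpToPhase.sum_mul_star_self {M : Matrix (ZMod 2) (ZMod 2) ℂ} {a b : ZMod 2}
    (hM : IsPauliUpToPhase M a b) : ∑ r, ∑ c, M r c * star (M r c) = 2 := by
  obtain ⟨φ, hφ, rfl⟩ := hM
  simp only [sum_zmod_two, Matrix.smul_apply, smul_eq_mul, star_mul']
  have h10 : (1 : ZMod 2) + 1 = 0 := rfl
  rcases zmod_two_cases a with rfl | rfl <;> rcases zmod_two_cases b with rfl | rfl <;>
    simp [xzMat, h10] <;> simp only [← Complex.star_def, hφ] <;> norm_num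

/-! ### Tensor products of one-qubit matrices -/

section

variable {n m a : ℕ}

/-- The tensor product of one-qubit matrices. -/
def tensorMat (f : Fin n → Matrix (ZMod 2) (ZMod 2) ℂ) :
    Matrix (Fin n → ZMod 2) (Fin n → ZMod 2) ℂ :=
  Matrix.of fun x y => ∏ j, f j (x j) (y j)

theorem pauliString_eq_tensorMat (P : Fin n → Pauli) :
    pauliString P = tensorMat fun j => (P j).mat := rfl

theorem tensorMat_one : tensorMat (fun _ : Fin n => 1) = 1 := by
  ext x y
  simp only [tensorMat, Matrix.of_apply, Matrix.one_apply, Finset.prod_ite_zero,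
    Finset.prod_const_one, Finset.mem_univ, true_implies, funext_iff]

theorem tensorMat_mul (f g : Fin n → Matrix (ZMod 2) (ZMod 2) ℂ) :
    tensorMat f * tensorMat g = tensorMat fun j => f j * g j := by
  ext x y
  simp only [tensorMat, Matrix.of_apply, Matrix.mul_apply, ← Finset.prod_mul_distrib]
  rw [Finset.prod_univ_sum, Fintype.piFinset_univ]

/-- By distributivity the Hilbert–Schmidt inner product factors over the qubits. -/
theorem sum_tensorMat_mul_star (f g : Fin n → Matrix (ZMod 2) (ZMod 2) ℂ) :
    ∑ x, ∑ y, tensorMat f x y * star (tensorMat g x y) =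
      ∏ j, ∑ r, ∑ c, f j r c * star (g j r c) := by
  simp only [tensorMat, Matrix.of_apply, star_prod, ← Finset.prod_mul_distrib]
  rw [Finset.prod_univ_sum, Fintype.piFinset_univ]
  refine Finset.sum_congr rfl fun x _ => ?_
  rw [Finset.prod_univ_sum, Fintype.piFinset_univ]

theorem Pauli.mat_mul_self (σ : Pauli) : σ.mat * σ.mat = 1 := by
  ext r c
  cases σ <;> rcases zmod_two_cases r with rfl | rfl <;>
    rcases zmod_two_cases c with rfl | rfl <;>
    simp [Pauli.mat, Matrix.mul_apply, sum_zmod_two]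

theorem Pauli.mat_star (σ : Pauli) (r c : ZMod 2) : star (σ.mat r c) = σ.mat c r := by
  cases σ <;> rcases zmod_two_cases r with rfl | rfl <;>
    rcases zmod_two_cases c with rfl | rfl <;> simp [Pauli.mat]

theorem pauliString_mul_self (P : Fin n → Pauli) : pauliString P * pauliString P = 1 := by
  simp only [pauliString_eq_tensorMat, tensorMat_mul, Pauli.mat_mul_self, tensorMat_one]

theorem pauliString_isHermitian (P : Fin n → Pauli) : (pauliString P).IsHermitian := by
  ext x y
  simp only [pauliString, Matrix.conjTranspose_apply, Matrix.of_apply, star_prod, Pauli.mat_star]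

/-! ### The steps of the algorithm on product states -/

theorem applyGates_bellPreparation (y : Fin m → ZMod 2) :
    applyGates bellPreparation (prodState (a := a) y fun _ : Fin n => Matrix.single 0 0 1) =
      prodState y fun _ => ((√2 : ℝ) : ℂ)⁻¹ • 1 := by
  have key := applyGates_flatMap_prodState (n := n) (m := m) (a := a) (y := y)
    (G := fun j => [.single .H (.B j), .cx (.B j) (.C j)])
    (T := fun _ M => Matrix.of fun b c => (OneQubit.H.mat * M) b (c + b))
    (fun j f => by
      rw [applyGates_cons, applyGates_cons, applyGates_nil, Gate.apply, applyCtrl_nil_B_prodState,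
        cx_B_C_prodState]
      simp)
    (List.finRange n) (List.nodup_finRange n) (List.mem_finRange)
    (fun _ => Matrix.single 0 0 1)
  rw [bellPreparation, key]
  congr 1
  funext j
  ext b c
  rcases zmod_two_cases b with rfl | rfl <;> rcases zmod_two_cases c with rfl | rfl <;>
    simp [Matrix.mul_apply, sum_zmod_two, OneQubit.mat, Matrix.single_apply,
      CharTwo.add_self_eq_zero]

theorem applyGates_bellMeasurement (y : Fin m → ZMod 2)
    (f : Fin n → Matrix (ZMod 2) (ZMod 2) ℂ) :
    applyGates bellMeasurement (prodState (a := a) y f) =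
      prodState y fun j => bellMap (f j) := by
  refine applyGates_flatMap_prodState (T := fun _ => bellMap) (fun j f => ?_)
    (List.finRange n) (List.nodup_finRange n) (List.mem_finRange) f
  simp only [applyGates_cons, applyGates_nil, cx_B_C_prodState, cx_C_B_prodState, Gate.apply.eq_1,
    applyCtrl_nil_B_prodState, Function.update_self, Function.update_idem]
  congr 2
  ext b c
  -- The last three controlled-NOTs compose to the exchange of the two indices.
  have h : b + (c + b) = c := by rw [add_comm c, ← add_assoc, CharTwo.add_self_eq_zero, zero_add]
  simp only [bellMap, Matrix.of_apply, h]
  rw [add_comm c b, add_add_self_zmod_two]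

theorem applyGates_bellMeasurement_reverse (y : Fin m → ZMod 2)
    (f : Fin n → Matrix (ZMod 2) (ZMod 2) ℂ) :
    applyGates bellMeasurement.reverse (prodState (a := a) y f) =
      prodState y fun j => bellUnmap (f j) := by
  rw [bellMeasurement, List.reverse_flatMap]
  refine applyGates_flatMap_prodState (T := fun _ => bellUnmap) (fun j f => ?_)
    (List.finRange n).reverse (List.nodup_reverse.2 (List.nodup_finRange n)) (by simp) f
  simp only [Function.comp_apply, List.reverse_cons, List.reverse_nil, List.nil_append,
    List.cons_append]
  simp only [applyGates_cons, applyGates_nil, cx_B_C_prodState, cx_C_B_prodState, Gate.apply.eq_1,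
    applyCtrl_nil_B_prodState, Function.update_self, Function.update_idem]
  congr 2
  ext b c
  have h : ∀ b c : ZMod 2, b + (c + b) = c := fun b c => by
    rw [add_comm c, ← add_assoc, CharTwo.add_self_eq_zero, zero_add]
  simp only [bellUnmap, Matrix.of_apply, Matrix.mul_apply]
  refine Finset.sum_congr rfl fun r _ => ?_
  have h' : ∀ s r : ZMod 2, s + r + s = r := fun s r => by rw [add_assoc, h]
  rw [h r (c + b), h']

theorem applyGates_controlledPauli (i : Fin m) (j : Fin n) (σ : Pauli) (y : Fin m → ZMod 2)
    (f : Fin n → Matrix (ZMod 2) (ZMod 2) ℂ) :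
    applyGates (controlledPauli i j σ) (prodState (a := a) y f) =
      prodState y (Function.update f j (if y i = 1 then σ.mat * f j else f j)) := by
  cases σ
  case I => simp [controlledPauli, Pauli.mat]
  all_goals
    simp only [controlledPauli, applyGates_cons, applyGates_nil, Gate.apply.eq_2,
      applyCtrl_A_B_prodState, OneQubit.mat]

/-- The product of the `j`-th factors of those `P i` with `y i = 1`. -/
noncomputable def PauliHamiltonian.factor (H : PauliHamiltonian n m) (y : Fin m → ZMod 2)
    (j : Fin n) (L : List (Fin m)) : Matrix (ZMod 2) (ZMod 2) ℂ :=
  L.foldl (fun M i => if y i = 1 then (H.P i j).mat * M else M) 1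

theorem PauliHamiltonian.foldl_eq_factor (H : PauliHamiltonian n m) (y : Fin m → ZMod 2)
    (j : Fin n) (L : List (Fin m)) (M : Matrix (ZMod 2) (ZMod 2) ℂ) :
    L.foldl (fun M i => if y i = 1 then (H.P i j).mat * M else M) M = H.factor y j L * M := by
  induction L generalizing M with
  | nil => simp [factor]
  | cons i L ih =>
    simp only [factor, List.foldl_cons]
    rw [ih, ih (if y i = 1 then _ else _)]
    split_ifs <;> simp [mul_assoc]

/-- The gate of the head of the list is applied first, so its Pauli is the rightmost factor. -/
theorem PauliHamiltonian.factor_cons (H : PauliHamiltonian n m) (y : Fin m → ZMod 2)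
    (j : Fin n) (i : Fin m) (L : List (Fin m)) :
    H.factor y j (i :: L) = H.factor y j L * if y i = 1 then (H.P i j).mat else 1 := by
  rw [factor, List.foldl_cons, H.foldl_eq_factor]
  split_ifs <;> simp

theorem applyGates_controlledPaulis (H : PauliHamiltonian n m) (y : Fin m → ZMod 2)
    (f : Fin n → Matrix (ZMod 2) (ZMod 2) ℂ) :
    applyGates (controlledPaulis H) (prodState (a := a) y f) =
      prodState y fun j => H.factor y j (List.finRange m) * f j := by
  rw [controlledPaulis]
  generalize List.finRange m = L
  induction L generalizing f with
  | nil => simp [PauliHamiltonian.factor]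
  | cons i L ih =>
    rw [List.flatMap_cons, applyGates_append,
      applyGates_flatMap_prodState (T := fun j M => if y i = 1 then (H.P i j).mat * M else M)
        (fun j f => applyGates_controlledPauli i j (H.P i j) y f) _ (List.nodup_finRange n)
        (List.mem_finRange), ih]
    congr 1
    funext j
    rw [H.factor_cons]
    split_ifs <;> simp [mul_assoc]

/-- The product of those signs `v i` with `y i = 1`. -/
def PauliHamiltonian.signProd (H : PauliHamiltonian n m) (y : Fin m → ZMod 2) : ℂ :=
  ∏ i, if y i = 1 then ((H.v i : ℤ) : ℂ) else 1

theorem PauliHamiltonian.sign_eq (H : PauliHamiltonian n m) (i : Fin m) :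
    ((H.v i : ℤ) : ℂ) = if H.v i = -1 then -1 else 1 := by
  rcases Int.units_eq_one_or (H.v i) with h | h <;> simp [h]

theorem applyGates_signPhases (H : PauliHamiltonian n m) (y : Fin m → ZMod 2)
    (f : Fin n → Matrix (ZMod 2) (ZMod 2) ℂ) :
    applyGates (signPhases H) (prodState (a := a) y f) = H.signProd y • prodState y f := by
  have key : ∀ L : List (Fin m), applyGates (L.flatMap fun i =>
        if H.v i = -1 then [.single .Z (.A i)] else []) (prodState (a := a) y f) =
      (L.map fun i => if y i = 1 then ((H.v i : ℤ) : ℂ) else 1).prod • prodState y f := by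
    intro L
    induction L with
    | nil => simp
    | cons i L ih =>
      rw [List.flatMap_cons, applyGates_append, List.map_cons, List.prod_cons, mul_smul, ← ih,
        ← (isLinearMap_applyGates _).map_smul, H.sign_eq]
      congr 1
      by_cases hv : H.v i = -1
      · simp only [hv, if_true, applyGates_cons, applyGates_nil, Z_A_prodState]
      · simp [hv]
  rw [signPhases, key, PauliHamiltonian.signProd, Fin.prod_univ_def]

/-- Each factor with `y i = 1` adds its symplectic bits modulo phases, and these sums are the
entries of the syndrome `Bᵀy`. This is what makes the outcome of the Bell measurement a syndrome. -/
theorem PauliHamiltonian.factor_isPauliUpToPhase (H : PauliHamiltonian n m)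
    (y : Fin m → ZMod 2) (j : Fin n) :
    IsPauliUpToPhase (H.factor y j (List.finRange m)) (H.checkMatrix.mulVec y (.inl j))
      (H.checkMatrix.mulVec y (.inr j)) := by
  have key : ∀ (L : List (Fin m)) (M : Matrix (ZMod 2) (ZMod 2) ℂ) (a b : ZMod 2),
      IsPauliUpToPhase M a b →
      IsPauliUpToPhase (L.foldl (fun M i => if y i = 1 then (H.P i j).mat * M else M) M)
        ((L.map fun i => (H.P i j).xBit * y i).sum + a)
        ((L.map fun i => (H.P i j).zBit * y i).sum + b) := by
    intro L
    induction L with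
    | nil => intro M a b h; simpa using h
    | cons i L ih =>
      intro M a b h
      rw [List.foldl_cons]
      rcases zmod_two_cases (y i) with hy | hy
      · simpa [hy] using ih _ _ _ h
      · have := ih _ _ _ (h.pauli_mul (H.P i j))
        simpa [hy, add_assoc, add_left_comm] using this
  have := key (List.finRange m) 1 0 0 isPauliUpToPhase_one
  rw [add_zero, add_zero, ← Fin.sum_univ_def, ← Fin.sum_univ_def] at this
  exact this

end

/-! ### Expansion of the polynomial in Pauli products, and its trace -/

section

variable {n m a : ℕ}

/-- Sums over weights become one sum over all strings with a cutoff in the coefficient, the form in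
which linear maps are applied term by term below. -/
theorem sum_hammingNorm_le {E : Type*} [AddCommGroup E] {R : Type*} [Ring R] [Module R E] (l : ℕ)
    (c : ℕ → R) (F : (Fin m → ZMod 2) → E) :
    ∑ j ∈ Finset.range (l + 1), c j • ∑ y : Fin m → ZMod 2 with hammingNorm y = j, F y =
      ∑ y, (if hammingNorm y ≤ l then c (hammingNorm y) else 0) • F y := by
  simp only [Finset.smul_sum, Finset.sum_filter, smul_ite, smul_zero]
  rw [Finset.sum_comm]
  refine Finset.sum_congr rfl fun y _ => ?_
  rw [Finset.sum_ite_eq]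
  simp only [Finset.mem_range, Nat.lt_succ_iff]
  split_ifs <;> simp

/-- The unsigned product `∏ᵢ Pᵢ ^ yᵢ`. -/
noncomputable def PauliHamiltonian.pauliProd (H : PauliHamiltonian n m) (y : Fin m → ZMod 2) :
    Matrix (Fin n → ZMod 2) (Fin n → ZMod 2) ℂ :=
  tensorMat fun j => H.factor y j (List.finRange m)

/-- The symmetric expansion is available in commutative rings only. It is applied in the real
algebra generated by the strings `P i`, which is commutative by `hH`, to `z i = v i • P i`; the
result is then mapped to matrices. -/
theorem PauliHamiltonian.aeval_mat {l : ℕ} (H : PauliHamiltonian n m) (hH : H.IsCommuting)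
    {p : Polynomial ℝ} {w : ℕ → ℝ} (hw : IsSymmetricExpansion m l p w) :
    Polynomial.aeval H.mat p =
      ∑ y : Fin m → ZMod 2, ((if hammingNorm y ≤ l then w (hammingNorm y) else 0 : ℝ) *
        H.signProd y : ℂ) • H.pauliProd y := by
  set S := Algebra.adjoin ℝ (Set.range fun i => pauliString (H.P i))
  have hS : IsMulCommutative S := Algebra.isMulCommutative_adjoin ℝ (by
    rintro _ ⟨i, rfl⟩ _ ⟨j, rfl⟩
    exact hH i j)
  let : CommRing S := { (inferInstance : Ring S) with mul_comm := hS.is_comm.comm }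
  let z : Fin m → S := fun i => ((H.v i : ℤ) : ℝ) •
    (⟨pauliString (H.P i), Algebra.subset_adjoin ⟨i, rfl⟩⟩ : S)
  have hval : ∀ i, S.val (z i) = ((H.v i : ℤ) : ℂ) • pauliString (H.P i) := by
    intro i
    rw [map_smul]
    ext x y
    simp [Subalgebra.val]
  have hz : ∀ i, z i ^ 2 = 1 := by
    intro i
    apply Subtype.val_injective
    change S.val (z i ^ 2) = S.val 1
    rw [map_pow, hval, map_one, sq, Matrix.smul_mul, Matrix.mul_smul, pauliString_mul_self,
      smul_smul]
    rcases Int.units_eq_one_or (H.v i) with h | h <;> simp [h]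
  have hprod : ∀ y : Fin m → ZMod 2,
      S.val (∏ i, z i ^ (y i).val) = H.signProd y • H.pauliProd y := by
    intro y
    have key : ∀ L : List (Fin m), S.val ((L.map fun i => z i ^ (y i).val).prod) =
        (L.map fun i => if y i = 1 then ((H.v i : ℤ) : ℂ) else 1).prod •
          tensorMat fun j => H.factor y j L := by
      intro L
      induction L with
      | nil => simp [factor, tensorMat_one]
      | cons i L ih =>
        -- The head is the leftmost factor of the list product but the rightmost one of `factor`;
        -- the exchange takes place inside the commutative algebra.
        rw [List.map_cons, List.prod_cons, mul_comm, map_mul, ih, List.map_cons, List.prod_cons,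
          map_pow, hval, mul_comm (ite _ _ _), mul_smul]
        simp only [H.factor_cons, ← tensorMat_mul, Matrix.smul_mul]
        congr 1
        rcases zmod_two_cases (y i) with hy | hy
        · simp [hy, tensorMat_one]
        · simp [hy, pauliString_eq_tensorMat, show ZMod.val (1 : ZMod 2) = 1 from rfl]
    rw [Fin.prod_univ_def, key, signProd, Fin.prod_univ_def, pauliProd]
  have hsum : H.mat = S.val (∑ i, z i) := by
    rw [map_sum]
    simp only [hval]
    rfl
  rw [hsum, Polynomial.aeval_algHom_apply, hw S z hz, sum_hammingNorm_le, map_sum]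
  refine Finset.sum_congr rfl fun y _ => ?_
  rw [map_smul, hprod, mul_smul]
  ext b c
  simp only [Matrix.smul_apply, Complex.real_smul, smul_eq_mul]

/-- Signs and coefficients are real and Pauli strings are Hermitian. -/
theorem PauliHamiltonian.star_aeval_mat (H : PauliHamiltonian n m) (p : Polynomial ℝ) :
    star (Polynomial.aeval H.mat p) = Polynomial.aeval H.mat p := by
  have hH : star H.mat = H.mat := by
    rw [PauliHamiltonian.mat, star_sum]
    refine Finset.sum_congr rfl fun i _ => ?_
    rw [star_smul, Matrix.star_eq_conjTranspose, pauliString_isHermitian]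
    simp
  induction p using Polynomial.induction_on' with
  | add p q hp hq => rw [map_add, star_add, hp, hq]
  | monomial k c =>
    rw [Polynomial.aeval_monomial, star_mul, star_pow, hH, Algebra.commutes, ← algebraMap_star_comm]
    simp

theorem card_hammingNorm_eq (m j : ℕ) :
    (Finset.univ.filter fun y : Fin m → ZMod 2 => hammingNorm y = j).card = m.choose j := by
  rw [← Finset.card_fin m, ← Finset.card_powersetCard, Finset.card_fin]
  refine Finset.card_bij (fun y _ => Finset.univ.filter fun i => y i ≠ 0) ?_ ?_ ?_
  · intro y hy
    rw [Finset.mem_powersetCard_univ]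
    exact (Finset.mem_filter.1 hy).2
  · intro y _ y' _ h
    funext i
    have := Finset.ext_iff.1 h i
    simp only [Finset.mem_filter, Finset.mem_univ, true_and] at this
    revert this
    generalize y i = b
    generalize y' i = c
    revert b c
    decide
  · intro s hs
    refine ⟨fun i => if i ∈ s then 1 else 0, ?_, ?_⟩
    · rw [Finset.mem_powersetCard_univ] at hs
      simp [hammingNorm, hs]
    · ext i
      simp

theorem sum_hammingNorm_sq (l : ℕ) (w : ℕ → ℝ) :
    ∑ y : Fin m → ZMod 2, (if hammingNorm y ≤ l then w (hammingNorm y) else 0) ^ 2 =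
      ∑ j ∈ Finset.range (l + 1), w j ^ 2 * (m.choose j : ℝ) := by
  have := sum_hammingNorm_le (m := m) l (fun j => w j ^ 2) (fun _ => (1 : ℝ))
  simp only [Finset.sum_const, card_hammingNorm_eq, nsmul_eq_mul, smul_eq_mul, mul_one] at this
  rw [this]
  refine Finset.sum_congr rfl fun y _ => ?_
  split_ifs <;> simp

/-- Errors of weight at most `l` are determined by their syndromes if a decoding oracle exists. -/
theorem PauliHamiltonian.IsDecodingOracle.syndrome_inj {H : PauliHamiltonian n m} {l : ℕ}
    {D : Matrix ((Fin m → ZMod 2) × (Fin n ⊕ Fin n → ZMod 2))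
      ((Fin m → ZMod 2) × (Fin n ⊕ Fin n → ZMod 2)) ℂ} (hD : H.IsDecodingOracle l D)
    {y y' : Fin m → ZMod 2} (hy : hammingNorm y ≤ l) (hy' : hammingNorm y' ≤ l)
    (h : H.checkMatrix.mulVec y = H.checkMatrix.mulVec y') : y = y' := by
  have h1 := hD.2 y hy
  have h2 := hD.2 y' hy'
  rw [← h, ← h1] at h2
  -- Both inputs have the same image under `D`, and `star D` undoes `D`.
  have h3 := congrArg (star D).mulVec h2
  rw [Matrix.mulVec_mulVec, Matrix.mulVec_mulVec, (Matrix.mem_unitaryGroup_iff'.1 hD.1),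
    Matrix.one_mulVec, Matrix.one_mulVec] at h3
  have h4 := congrFun h3 (y, H.checkMatrix.mulVec y)
  rw [Pi.single_apply, Pi.single_eq_same] at h4
  by_contra hne
  rw [if_neg (by simp [hne])] at h4
  exact zero_ne_one h4

theorem PauliHamiltonian.sum_pauliProd_mul_star (H : PauliHamiltonian n m)
    (y : Fin m → ZMod 2) :
    ∑ b, ∑ c, H.pauliProd y b c * star (H.pauliProd y b c) = 2 ^ n := by
  simp only [pauliProd, sum_tensorMat_mul_star, (H.factor_isPauliUpToPhase y _).sum_mul_star_self]
  simp

/-- At some qubit the syndromes differ; there the one-qubit factors are orthogonal Paulis, and the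
whole product of inner products vanishes. -/
theorem PauliHamiltonian.sum_pauliProd_mul_star_of_ne (H : PauliHamiltonian n m)
    {y y' : Fin m → ZMod 2} (h : H.checkMatrix.mulVec y ≠ H.checkMatrix.mulVec y') :
    ∑ b, ∑ c, H.pauliProd y b c * star (H.pauliProd y' b c) = 0 := by
  obtain ⟨j, hj⟩ : ∃ j : Fin n,
      (H.checkMatrix.mulVec y (.inl j), H.checkMatrix.mulVec y (.inr j)) ≠
        (H.checkMatrix.mulVec y' (.inl j), H.checkMatrix.mulVec y' (.inr j)) := by
    by_contra! hall
    apply h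
    funext r
    rcases r with j | j
    · exact (Prod.mk.injEq _ _ _ _ ▸ hall j).1
    · exact (Prod.mk.injEq _ _ _ _ ▸ hall j).2
  simp only [pauliProd, sum_tensorMat_mul_star]
  exact Finset.prod_eq_zero (Finset.mem_univ j)
    ((H.factor_isPauliUpToPhase y j).sum_mul_star (H.factor_isPauliUpToPhase y' j) hj)

theorem PauliHamiltonian.signProd_mul_star (H : PauliHamiltonian n m) (y : Fin m → ZMod 2) :
    H.signProd y * star (H.signProd y) = 1 := by
  rw [signProd, star_prod, ← Finset.prod_mul_distrib]
  refine Finset.prod_eq_one fun i _ => ?_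
  rw [H.sign_eq]
  split_ifs <;> simp

/-- Since `𝒫(H)` is Hermitian, the trace of its square is its squared Hilbert–Schmidt norm. By
`hinj` the products `P^y` that occur are pairwise orthogonal, each of squared norm `2 ^ n`, so the
norm is computed by Pythagoras. -/
theorem PauliHamiltonian.trace_aeval_sq {l : ℕ} (H : PauliHamiltonian n m) (hH : H.IsCommuting)
    {p : Polynomial ℝ} {w : ℕ → ℝ} (hw : IsSymmetricExpansion m l p w)
    (hinj : ∀ y y' : Fin m → ZMod 2, hammingNorm y ≤ l → hammingNorm y' ≤ l →
      H.checkMatrix.mulVec y = H.checkMatrix.mulVec y' → y = y') :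
    (Polynomial.aeval H.mat p ^ 2).trace =
      2 ^ n * ((∑ j ∈ Finset.range (l + 1), w j ^ 2 * (m.choose j : ℝ) : ℝ) : ℂ) := by
  have hsq : (Polynomial.aeval H.mat p ^ 2).trace = ∑ b, ∑ c,
      Polynomial.aeval H.mat p b c * star (Polynomial.aeval H.mat p b c) := by
    rw [sq]
    nth_rewrite 2 [← H.star_aeval_mat p]
    simp only [Matrix.trace, Matrix.diag_apply, Matrix.mul_apply, Matrix.star_apply]
  rw [hsq, H.aeval_mat hH hw, ← sum_hammingNorm_sq]
  set β : (Fin m → ZMod 2) → ℝ := fun y => if hammingNorm y ≤ l then w (hammingNorm y) else 0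
  have hcross : ∀ y y' : Fin m → ZMod 2,
      ∑ b, ∑ c, (((β y : ℂ) * H.signProd y) * H.pauliProd y b c) *
        star (((β y' : ℂ) * H.signProd y') * H.pauliProd y' b c) =
      if y = y' then 2 ^ n * (β y : ℂ) ^ 2 else 0 := by
    intro y y'
    have hfac : ∑ b, ∑ c, (((β y : ℂ) * H.signProd y) * H.pauliProd y b c) *
          star (((β y' : ℂ) * H.signProd y') * H.pauliProd y' b c) =
        (((β y : ℂ) * H.signProd y) * star ((β y' : ℂ) * H.signProd y')) *
          ∑ b, ∑ c, H.pauliProd y b c * star (H.pauliProd y' b c) := by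
      simp only [Finset.mul_sum]
      refine Finset.sum_congr rfl fun b _ => Finset.sum_congr rfl fun c _ => ?_
      simp only [star_mul']
      ring
    rw [hfac]
    split_ifs with h
    · subst h
      rw [H.sum_pauliProd_mul_star, star_mul', Complex.star_def, Complex.conj_ofReal,
        ← Complex.star_def]
      linear_combination (β y : ℂ) ^ 2 * 2 ^ n * H.signProd_mul_star y
    -- Injectivity is known only up to weight `l`; beyond it `β` vanishes.
    · by_cases hy : hammingNorm y ≤ l
      · by_cases hy' : hammingNorm y' ≤ l
        · rw [H.sum_pauliProd_mul_star_of_ne fun hs => h (hinj y y' hy hy' hs), mul_zero]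
        · simp [β, hy']
      · simp [β, hy]
  simp only [Matrix.sum_apply, Matrix.smul_apply, smul_eq_mul, star_sum, Finset.sum_mul_sum]
  calc _ = ∑ y, ∑ y', ∑ b, ∑ c, (((β y : ℂ) * H.signProd y) * H.pauliProd y b c) *
        star (((β y' : ℂ) * H.signProd y') * H.pauliProd y' b c) := by
        rw [Finset.sum_congr rfl fun b _ => Finset.sum_comm, Finset.sum_comm]
        refine Finset.sum_congr rfl fun y _ => ?_
        rw [Finset.sum_congr rfl fun b _ => Finset.sum_comm, Finset.sum_comm]
    _ = _ := by
        simp only [hcross, Finset.sum_ite_eq, Finset.mem_univ, if_true]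
        rw [← Finset.mul_sum]
        push_cast
        rfl

/-! ### Correctness of the algorithm -/

theorem applyOracle_single (D : Matrix ((Fin m → ZMod 2) × (Fin n ⊕ Fin n → ZMod 2))
      ((Fin m → ZMod 2) × (Fin n ⊕ Fin n → ZMod 2)) ℂ)
    {y y' : Fin m → ZMod 2} {s : Fin n ⊕ Fin n → ZMod 2}
    (h : D.mulVec (Pi.single (y, s) 1) = Pi.single (y', s) 1) :
    applyOracle D (Pi.single (Wire.bits y s 0) 1 : QState (Wire n m a)) =
      Pi.single (Wire.bits y' s 0) 1 := by
  have hbits : ∀ (y₁ y₂ : Fin m → ZMod 2) (s₁ s₂ : Fin n ⊕ Fin n → ZMod 2)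
      (w₁ w₂ : Fin a → ZMod 2), Wire.bits y₁ s₁ w₁ = Wire.bits y₂ s₂ w₂ ↔
        (y₁, s₁) = (y₂, s₂) ∧ w₁ = w₂ := by
    intro y₁ y₂ s₁ s₂ w₁ w₂
    simp only [Wire.bits, Sum.elim_eq_iff, Prod.mk.injEq, and_assoc]
  funext x
  obtain ⟨y₁, s₁, w₁, rfl⟩ : ∃ y₁ s₁ w₁, x = Wire.bits y₁ s₁ w₁ :=
    ⟨fun i => x (.inl i), fun r => x (.inr (.inl r)), fun k => x (.inr (.inr k)), by
      funext r; rcases r with r | r | r <;> rfl⟩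
  have h' := congrFun h (y₁, s₁)
  simp only [Matrix.mulVec, dotProduct] at h'
  simp only [applyOracle]
  change ∑ ys, D (y₁, s₁) ys *
    Pi.single (M := fun _ => ℂ) (Wire.bits y s 0) (1 : ℂ) (Wire.bits ys.1 ys.2 w₁) = _
  simp only [Pi.single_apply, hbits] at h' ⊢
  by_cases hw : w₁ = 0
  · simpa [hw] using h'
  · simp [hw]

theorem pilotState_eq_sum (l : ℕ) (w : ℕ → ℝ) :
    pilotState n m a l w = ∑ y : Fin m → ZMod 2,
      (((√(∑ j ∈ Finset.range (l + 1), w j ^ 2 * (m.choose j : ℝ)))⁻¹ *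
        (if hammingNorm y ≤ l then w (hammingNorm y) else 0) : ℝ) : ℂ) •
        Pi.single (Wire.bits y 0 0) 1 := by
  rw [pilotState, sum_hammingNorm_le l (fun j => (w j : ℂ)), Finset.smul_sum]
  refine Finset.sum_congr rfl fun y _ => ?_
  rw [smul_smul]
  push_cast
  split_ifs <;> simp

/-- By linearity each branch `y` is followed separately. The oracle changes only register `A`, so
the phase produced by the Bell measurement is still there when the reversed circuit runs, and is
undone by it. Afterwards all branches share `A = 0` and add up coherently. -/
theorem applySteps_hdqiCircuit_zeroState {l : ℕ} (H : PauliHamiltonian n m) (w : ℕ → ℝ)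
    {pilot : List (Gate (Wire n m a) ℝ)}
    (hpilot : applyGates pilot (zeroState _) = pilotState n m a l w)
    {D : Matrix ((Fin m → ZMod 2) × (Fin n ⊕ Fin n → ZMod 2))
      ((Fin m → ZMod 2) × (Fin n ⊕ Fin n → ZMod 2)) ℂ} (hD : H.IsDecodingOracle l D) :
    applySteps D (hdqiCircuit H pilot) (zeroState _) =
      ∑ y : Fin m → ZMod 2,
        ((((√(∑ j ∈ Finset.range (l + 1), w j ^ 2 * (m.choose j : ℝ)))⁻¹ *
          (if hammingNorm y ≤ l then w (hammingNorm y) else 0) : ℝ) : ℂ) * H.signProd y) •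
        prodState 0 fun j => ((√2 : ℝ) : ℂ)⁻¹ • H.factor y j (List.finRange m) := by
  set N := (√(∑ j ∈ Finset.range (l + 1), w j ^ 2 * (m.choose j : ℝ)))⁻¹
  choose φ hφ hbell using fun (y : Fin m → ZMod 2) (j : Fin n) =>
    (H.factor_isPauliUpToPhase y j).bellMap
  have hmeas : ∀ y y' : Fin m → ZMod 2,
      applyGates bellMeasurement (prodState (a := a) y' fun j =>
          ((√2 : ℝ) : ℂ)⁻¹ • H.factor y j (List.finRange m)) =
        (∏ j, φ y j) • Pi.single (Wire.bits y' (H.checkMatrix.mulVec y) 0) 1 := by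
    intro y y'
    rw [applyGates_bellMeasurement]
    simp only [hbell]
    rw [prodState_smul, prodState_single]
  have hrev : ∀ y : Fin m → ZMod 2, (∏ j, φ y j) •
      applyGates bellMeasurement.reverse
        (Pi.single (Wire.bits 0 (H.checkMatrix.mulVec y) 0) 1 : QState (Wire n m a)) =
      prodState 0 fun j => ((√2 : ℝ) : ℂ)⁻¹ • H.factor y j (List.finRange m) := by
    intro y
    -- The phase does not depend on the content of `A`, so this state is also the measured state of
    -- the branch with `A = 0`, to which the reversed circuit is the inverse.
    rw [← (isLinearMap_applyGates _).map_smul, ← hmeas, applyGates_bellMeasurement,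
      applyGates_bellMeasurement_reverse]
    simp only [bellUnmap_bellMap]
  rw [applySteps_hdqiCircuit, hpilot, pilotState_eq_sum]
  have hsingle : ∀ y : Fin m → ZMod 2, (Pi.single (Wire.bits y 0 0) 1 : QState (Wire n m a)) =
      prodState y fun _ => Matrix.single 0 0 1 := fun y => (prodState_single y 0).symm
  simp only [hsingle, IsLinearMap.map_sum_smul (isLinearMap_applyGates _),
    applyGates_bellPreparation, applyGates_signPhases, (isLinearMap_applyGates _).map_smul,
    applyGates_controlledPaulis, Matrix.mul_smul, mul_one, hmeas]
  rw [IsLinearMap.map_sum_smul (isLinearMap_applyOracle D),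
    IsLinearMap.map_sum_smul (isLinearMap_applyGates _)]
  refine Finset.sum_congr rfl fun y _ => ?_
  -- The action of the oracle is unknown above weight `l`, but there the amplitude is zero.
  by_cases hy : hammingNorm y ≤ l
  · rw [(isLinearMap_applyOracle D).map_smul, (isLinearMap_applyOracle D).map_smul,
      applyOracle_single D (hD.2 y hy), (isLinearMap_applyGates _).map_smul,
      (isLinearMap_applyGates _).map_smul, hrev, mul_smul]
  · simp [hy]

/-- The final amplitudes on `BC` are the entries of `𝒫(H)` up to the factor `1 / √(N 2ⁿ)`. Tracing
out `C` multiplies this matrix by its adjoint, and `𝒫(H)` is Hermitian; the trace formula identifies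
`N 2ⁿ` with the required normalization. -/
theorem reducedB_hdqiCircuit {l : ℕ} (H : PauliHamiltonian n m) (hH : H.IsCommuting)
    {p : Polynomial ℝ} {w : ℕ → ℝ} (hw : IsSymmetricExpansion m l p w)
    {pilot : List (Gate (Wire n m a) ℝ)}
    (hpilot : applyGates pilot (zeroState _) = pilotState n m a l w)
    {D : Matrix ((Fin m → ZMod 2) × (Fin n ⊕ Fin n → ZMod 2))
      ((Fin m → ZMod 2) × (Fin n ⊕ Fin n → ZMod 2)) ℂ} (hD : H.IsDecodingOracle l D) :
    reducedB (applySteps D (hdqiCircuit H pilot) (zeroState _)) = H.polyState p := by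
  set N := ∑ j ∈ Finset.range (l + 1), w j ^ 2 * (m.choose j : ℝ) with hN
  have hN0 : 0 ≤ N := Finset.sum_nonneg fun j _ => by positivity
  have hamp : ∀ (y : Fin m → ZMod 2) (b c : Fin n → ZMod 2) (v : Fin a → ZMod 2),
      applySteps D (hdqiCircuit H pilot) (zeroState _) (Wire.bits y (Sum.elim b c) v) =
        if y = 0 ∧ v = 0 then
          ((√N : ℝ) : ℂ)⁻¹ * ((√2 : ℝ) : ℂ)⁻¹ ^ n * Polynomial.aeval H.mat p b c else 0 := by
    intro y b c v
    rw [applySteps_hdqiCircuit_zeroState H w hpilot hD, H.aeval_mat hH hw, Matrix.sum_apply,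
      Finset.sum_apply, ← hN]
    have h0 : ∀ f : Fin n → Matrix (ZMod 2) (ZMod 2) ℂ,
        prodState 0 f (Wire.bits y (Sum.elim b c) v) =
          if y = 0 ∧ v = 0 then tensorMat f b c else 0 := by
      intro f
      simp only [prodState, funext_iff]
      rfl
    split_ifs with h
    · rw [Finset.mul_sum]
      refine Finset.sum_congr rfl fun y' _ => ?_
      rw [prodState_smul, Pi.smul_apply, Pi.smul_apply, h0, if_pos h, Matrix.smul_apply,
        Finset.prod_const, Finset.card_fin]
      simp only [smul_eq_mul, PauliHamiltonian.pauliProd]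
      push_cast
      ring
    · refine Finset.sum_eq_zero fun y' _ => ?_
      rw [Pi.smul_apply, h0, if_neg h, smul_zero]
  ext b b₂
  have hstar : ∀ c, star (Polynomial.aeval H.mat p b₂ c) = Polynomial.aeval H.mat p c b₂ := by
    intro c
    nth_rewrite 2 [← H.star_aeval_mat p]
    rw [Matrix.star_apply]
  rw [PauliHamiltonian.polyState, H.trace_aeval_sq hH hw fun y y' => hD.syndrome_inj, ← hN,
    reducedB, Matrix.of_apply, Matrix.smul_apply, sq, Matrix.mul_apply, Finset.smul_sum,
    Finset.sum_eq_single 0]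
  · refine Finset.sum_congr rfl fun c _ => ?_
    rw [Finset.sum_eq_single 0]
    · rw [hamp, hamp, if_pos ⟨rfl, rfl⟩, if_pos ⟨rfl, rfl⟩, star_mul', hstar]
      -- This also holds for `N = 0`, where both sides are `0`.
      have h1 : ((√N : ℝ) : ℂ)⁻¹ * ((√N : ℝ) : ℂ)⁻¹ = (N : ℂ)⁻¹ := by
        rw [← mul_inv, ← Complex.ofReal_mul, Real.mul_self_sqrt hN0]
      have h2 : ((√2 : ℝ) : ℂ)⁻¹ ^ n * ((√2 : ℝ) : ℂ)⁻¹ ^ n = (2 ^ n)⁻¹ := by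
        rw [← mul_pow, sqrt_two_inv_mul_self, one_div, inv_pow]
      have h3 : star (((√N : ℝ) : ℂ)⁻¹ * ((√2 : ℝ) : ℂ)⁻¹ ^ n) =
          ((√N : ℝ) : ℂ)⁻¹ * ((√2 : ℝ) : ℂ)⁻¹ ^ n := by
        simp
      rw [h3, smul_eq_mul, mul_inv, ← h1, ← h2]
      ring
    · intro v _ hv
      rw [hamp, if_neg (by simp [hv]), zero_mul]
    · simp
  · intro y _ hy
    refine Finset.sum_eq_zero fun c _ => Finset.sum_eq_zero fun v _ => ?_
    rw [hamp, if_neg (by simp [hy]), zero_mul]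
  · simp

end

/-! ### Expansion into elementary symmetric polynomials -/

section

variable {m : ℕ}

theorem hammingNorm_add_single (y : Fin m → ZMod 2) (i : Fin m) :
    hammingNorm (y + Pi.single i 1) =
      if y i = 1 then hammingNorm y - 1 else hammingNorm y + 1 := by
  have h10 : (1 : ZMod 2) + 1 = 0 := rfl
  simp only [hammingNorm]
  rcases zmod_two_cases (y i) with h | h
  · rw [if_neg (by simp [h]), ← Finset.card_insert_of_notMem (a := i) (by simp [h])]
    congr 1
    ext k
    by_cases hk : k = i
    · subst hk; simp [h]
    · simp [hk]
  · rw [if_pos h, ← Finset.card_erase_of_mem (a := i) (by simp [h])]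
    congr 1
    ext k
    by_cases hk : k = i
    · subst hk; simp [h, h10]
    · simp [hk]

/-- Since `z i ^ 2 = 1`, exponents matter modulo `2` only, and multiplication by `z i` flips the
`i`-th one. -/
theorem mul_prod_pow_add_single {R : Type*} [CommRing R] (z : Fin m → R) (hz : ∀ i, z i ^ 2 = 1)
    (y : Fin m → ZMod 2) (i : Fin m) :
    z i * ∏ k, z k ^ ((y + Pi.single i 1 : Fin m → ZMod 2) k).val = ∏ k, z k ^ (y k).val := by
  have h10 : ((1 : ZMod 2) + 1).val = 0 := rfl
  have h1 : (1 : ZMod 2).val = 1 := rfl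
  rw [← Finset.mul_prod_erase _ _ (Finset.mem_univ i),
    ← Finset.mul_prod_erase _ (fun k => z k ^ (y k).val) (Finset.mem_univ i), ← mul_assoc]
  congr 1
  · rcases zmod_two_cases (y i) with h | h
    · simp [h, h1, ← sq, hz]
    · simp [h, h1, h10]
  · refine Finset.prod_congr rfl fun k hk => ?_
    rw [Pi.add_apply, Pi.single_eq_of_ne (Finset.ne_of_mem_erase hk), add_zero]

/-- The coefficient at `y` collects those of its `m` neighbours in the hypercube: flipping one of
the `|y|` ones gives weight `|y| - 1`, flipping one of the `m - |y|` zeros gives weight `|y| + 1`.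
The truncated `|y| - 1` at `y = 0` carries the factor `0`. -/
theorem sum_mul_sum_hammingNorm {R : Type*} [CommRing R] [Algebra ℝ R] (z : Fin m → R)
    (hz : ∀ i, z i ^ 2 = 1) (c : ℕ → ℝ) :
    (∑ i, z i) * ∑ y : Fin m → ZMod 2, c (hammingNorm y) • ∏ k, z k ^ (y k).val =
      ∑ y : Fin m → ZMod 2, ((hammingNorm y : ℝ) * c (hammingNorm y - 1) +
        ((m - hammingNorm y : ℕ) : ℝ) * c (hammingNorm y + 1)) • ∏ k, z k ^ (y k).val := by
  calc _ = ∑ i, ∑ y : Fin m → ZMod 2,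
        (if y i = 1 then c (hammingNorm y - 1) else c (hammingNorm y + 1)) •
          ∏ k, z k ^ (y k).val := by
        rw [Finset.sum_mul]
        refine Finset.sum_congr rfl fun i _ => ?_
        -- Multiplication by `z i` translates the exponent by the `i`-th unit vector; the sum is
        -- reindexed by this involution.
        rw [Finset.mul_sum, ← Equiv.sum_comp (Equiv.addRight (Pi.single i (1 : ZMod 2)))]
        refine Finset.sum_congr rfl fun y _ => ?_
        rw [Equiv.coe_addRight, mul_smul_comm, mul_prod_pow_add_single z hz,
          hammingNorm_add_single, apply_ite c]
    _ = _ := by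
        rw [Finset.sum_comm]
        refine Finset.sum_congr rfl fun y _ => ?_
        rw [← Finset.sum_smul]
        congr 1
        have h1 : (Finset.univ.filter fun i => y i = 1).card = hammingNorm y := by
          rw [hammingNorm]
          congr 1
          ext i
          rcases zmod_two_cases (y i) with h | h <;> simp [h]
        have h0 : (Finset.univ.filter fun i => ¬ y i = 1).card = m - hammingNorm y := by
          rw [Finset.filter_not, Finset.card_univ_sdiff, Fintype.card_fin, h1]
        rw [Finset.sum_ite, Finset.sum_const, Finset.sum_const, h0, h1, nsmul_eq_mul, nsmul_eq_mul]

theorem hammingNorm_le (y : Fin m → ZMod 2) : hammingNorm y ≤ m := by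
  simpa using hammingNorm_le_card_fintype (x := y)

/-- Horner's scheme in the basis of elementary symmetric polynomials: in row `t`, column `j + 1`
holds the coefficient of the `j`-th elementary symmetric polynomial after `t` steps. -/
structure IsHornerTable (m l : ℕ) (c : ℕ → ℝ) (V : ℕ → ℕ → ℝ) : Prop where
  row_zero : ∀ j, V 0 j = 0
  col_zero : ∀ t, V t 0 = 0
  succ : ∀ t ≤ l, ∀ j ≤ m, V (t + 1) (j + 1) =
    j * V t j + ((m - j : ℕ) : ℝ) * V t (j + 2) + if j = 0 then c (l - t) else 0

/-- After `t` steps of Horner's scheme the polynomial has degree less than `t`, hence no symmetric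
component of degree `t` or more. -/
theorem IsHornerTable.eq_zero {l : ℕ} {c : ℕ → ℝ} {V : ℕ → ℕ → ℝ} (h : IsHornerTable m l c V)
    {t j : ℕ} (ht : t ≤ l + 1) (htj : t ≤ j) (hj : j ≤ m) : V t (j + 1) = 0 := by
  induction t generalizing j with
  | zero => exact h.row_zero _
  | succ t ih =>
    obtain ⟨k, rfl⟩ : ∃ k, j = k + 1 := ⟨j - 1, by omega⟩
    rw [h.succ t (by omega) (k + 1) hj, ih (by omega) (by omega) (by omega), if_neg (by omega)]
    rcases Nat.lt_or_ge (k + 1) m with hk | hk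
    · rw [ih (by omega) (by omega) (by omega)]
      ring
    -- At the right edge the recurrence refers to a column beyond `m + 1`, with coefficient `m - m =
    -- 0`.
    · rw [Nat.sub_eq_zero_of_le hk]
      simp

/-- Row `t` represents the polynomial formed from the top `t` coefficients, evaluated at `∑ z i`. A
step multiplies by `∑ z i`, which is `sum_mul_sum_hammingNorm`, and adds the coefficient of index `l
- t` to the constant term, which sits at `y = 0`. -/
theorem IsHornerTable.isSymmetricExpansion {l : ℕ} {p : Polynomial ℝ} {V : ℕ → ℕ → ℝ}
    (h : IsHornerTable m l p.coeff V) (hp : p.natDegree ≤ l) :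
    IsSymmetricExpansion m l p fun j => V (l + 1) (j + 1) := by
  intro R _ _ z hz
  have key : ∀ t ≤ l + 1, ∑ y : Fin m → ZMod 2,
      V t (hammingNorm y + 1) • ∏ k, z k ^ (y k).val =
        ∑ k ∈ Finset.range t, p.coeff (l + 1 - t + k) • (∑ i, z i) ^ k := by
    intro t
    induction t with
    | zero => intro _; simp [h.row_zero]
    | succ t ih =>
      intro ht
      have hmul := sum_mul_sum_hammingNorm z hz fun j => V t (j + 1)
      rw [ih (by omega), Finset.mul_sum] at hmul
      rw [Finset.sum_range_succ']
      have h1 : ∑ k ∈ Finset.range t,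
          p.coeff (l + 1 - (t + 1) + (k + 1)) • (∑ i, z i) ^ (k + 1) =
          ∑ k ∈ Finset.range t, (∑ i, z i) * p.coeff (l + 1 - t + k) • (∑ i, z i) ^ k := by
        refine Finset.sum_congr rfl fun k _ => ?_
        rw [mul_smul_comm, pow_succ', show l + 1 - (t + 1) + (k + 1) = l + 1 - t + k by omega]
      rw [h1, hmul]
      have h2 : p.coeff (l + 1 - (t + 1) + 0) • (∑ i, z i) ^ 0 =
          ∑ y : Fin m → ZMod 2, (if hammingNorm y = 0 then p.coeff (l - t) else 0) •
            ∏ k, z k ^ (y k).val := by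
        rw [Finset.sum_eq_single (0 : Fin m → ZMod 2)]
        · simp [show l + 1 - (t + 1) = l - t by omega]
        · intro y _ hy
          rw [if_neg (by simpa using hy), zero_smul]
        · simp
      rw [h2, ← Finset.sum_add_distrib]
      refine Finset.sum_congr rfl fun y _ => ?_
      rw [← add_smul, h.succ t (by omega) _ (hammingNorm_le y)]
      congr 3
      -- At weight `0` the truncated index `0 - 1 + 1` is `1` rather than `0`, but its coefficient
      -- is `0`.
      rcases Nat.eq_zero_or_pos (hammingNorm y) with h0 | h0
      · simp [h0]
      · rw [Nat.sub_add_cancel h0]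
  have := key (l + 1) le_rfl
  simp only [Nat.sub_self, zero_add] at this
  rw [Polynomial.aeval_eq_sum_range' (Nat.lt_succ_of_le hp), ← this, sum_hammingNorm_le]
  refine Finset.sum_congr rfl fun y _ => ?_
  split_ifs with hy
  · rfl
  · rw [h.eq_zero le_rfl (by omega) (hammingNorm_le y)]

theorem sum_ite_lt_sub {m k : ℕ} (hk : k ≤ m) :
    ∑ i : Fin m, (if (i : ℕ) < k then 1 else -1 : ℝ) = 2 * k - m := by
  rw [Fin.sum_univ_eq_sum_range (fun i => if i < k then 1 else -1 : ℕ → ℝ)]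
  obtain ⟨d, rfl⟩ := Nat.exists_eq_add_of_le hk
  rw [Finset.sum_range_add, Finset.sum_congr rfl fun i hi => if_pos (Finset.mem_range.1 hi)]
  simp
  ring

/-- If all weights vanished, substituting signs `±1` for the `z i` would make `p` vanish at the `m +
1` numbers `2k - m`, more than its degree allows. -/
theorem IsSymmetricExpansion.exists_ne_zero {l : ℕ} {p : Polynomial ℝ} {w : ℕ → ℝ}
    (hw : IsSymmetricExpansion m l p w) (hl : l ≤ m) (hp : p.natDegree ≤ l) (hp0 : p ≠ 0) :
    ∃ j ≤ l, w j ≠ 0 := by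
  by_contra! h
  apply hp0
  refine Polynomial.eq_zero_of_natDegree_lt_card_of_eval_eq_zero p
    (f := fun k : Fin (m + 1) => (2 * (k : ℕ) - m : ℝ)) ?_ ?_ ?_
  · intro k k' hk
    simp only at hk
    have : ((k : ℕ) : ℝ) = (k' : ℕ) := by linarith
    exact Fin.ext (by exact_mod_cast this)
  · intro k
    have := hw ℝ (fun i => if (i : ℕ) < k then 1 else -1) (fun i => by split_ifs <;> norm_num)
    rw [sum_ite_lt_sub (Nat.lt_succ_iff.1 k.2), Polynomial.coe_aeval_eq_eval] at this
    rw [this]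
    refine Finset.sum_eq_zero fun j hj => ?_
    rw [h j (Nat.lt_succ_iff.1 (Finset.mem_range.1 hj)), zero_smul]
  · rw [Fintype.card_fin]
    omega

/-! ### Rotation parameters -/

/-- In row `t`, column `k` holds the norm of the unnormalized amplitudes `w |y|` of those `y` that
extend a given string of weight `k` by `t` bits; the row `t = 0` holds the amplitudes. -/
structure IsRotationTable (m : ℕ) (w : ℕ → ℝ) (g : ℕ → ℕ → ℝ) : Prop where
  zero : ∀ k ≤ m, g 0 k = w k
  succ : ∀ t < m, ∀ k < m, g (t + 1) k = √(g t k ^ 2 + g t (k + 1) ^ 2)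

/-- Among the extensions by `t` bits of a string of weight `k`, `t.choose j` have weight `k + j`;
the recurrence for the squares is Pascal's rule. -/
theorem IsRotationTable.sq_eq {w : ℕ → ℝ} {g : ℕ → ℕ → ℝ} (h : IsRotationTable m w g)
    (t k : ℕ) (htk : k + t ≤ m) :
    g t k ^ 2 = ∑ j ∈ Finset.range (t + 1), (t.choose j : ℝ) * w (k + j) ^ 2 := by
  induction t generalizing k with
  | zero => simp [h.zero k htk]
  | succ t ih =>
    rw [h.succ t (by omega) k (by omega), Real.sq_sqrt (by positivity), ih k (by omega),
      ih (k + 1) (by omega)]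
    have h1 : ∑ j ∈ Finset.range (t + 1), (t.choose j : ℝ) * w (k + j) ^ 2 =
        ∑ j ∈ Finset.range (t + 1), (t.choose (j + 1) : ℝ) * w (k + (j + 1)) ^ 2 + w k ^ 2 := by
      have h2 := Finset.sum_range_succ (fun j => (t.choose j : ℝ) * w (k + j) ^ 2) (t + 1)
      rw [Nat.choose_eq_zero_of_lt (Nat.lt_succ_self t), Finset.sum_range_succ'] at h2
      simpa using h2.symm
    rw [h1, Finset.sum_range_succ' _ (t + 1)]
    simp only [Nat.choose_succ_succ, Nat.cast_add, add_mul, Finset.sum_add_distrib,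
      Nat.choose_zero_right, Nat.cast_one, one_mul, add_zero, add_assoc, add_comm (1 : ℕ)]
    ring

/-- The absolute value matters only for `m = 0`, where `g 0 0 = w 0` may be negative; all later rows
used here are square roots. -/
theorem IsRotationTable.sqrt_eq_abs {l : ℕ} {w : ℕ → ℝ} {g : ℕ → ℕ → ℝ}
    (h : IsRotationTable m w g) (hl : l ≤ m) (hw : ∀ k, l < k → k ≤ m → w k = 0) :
    √(∑ j ∈ Finset.range (l + 1), w j ^ 2 * (m.choose j : ℝ)) = |g m 0| := by
  rw [← Real.sqrt_sq_eq_abs, h.sq_eq m 0 (by omega)]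
  congr 1
  rw [← Finset.sum_subset (Finset.range_mono (Nat.succ_le_succ hl))]
  · refine Finset.sum_congr rfl fun j _ => ?_
    rw [zero_add, mul_comm]
  · intro j hj hj'
    simp only [Finset.mem_range] at hj hj'
    rw [zero_add, hw j (by omega) (by omega)]
    ring

end

/-! ### Gates on basis states -/

theorem applyCtrl_single {W : Type} [Fintype W] [DecidableEq W] {cs : List W} {t : W} (ht : t ∉ cs)
    (u : Matrix (ZMod 2) (ZMod 2) ℂ) (x : W → ZMod 2) :
    applyCtrl cs u t (Pi.single x 1) =
      if ∀ c ∈ cs, x c = 1 then ∑ b, u b (x t) • (Pi.single (Function.update x t b) 1 : QState W)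
      else Pi.single x 1 := by
  funext x'
  -- A gate changes only its target, so both sides vanish at `x'` unless `x'` agrees with `x` on all
  -- other wires.
  by_cases hx : ∀ s, s ≠ t → x' s = x s
  · have hx' : x' = Function.update x t (x' t) := by
      funext s
      by_cases hs : s = t
      · subst hs; simp
      · rw [Function.update_of_ne hs, hx s hs]
    have hcond : (t ∉ cs ∧ ∀ c ∈ cs, x' c = 1) ↔ ∀ c ∈ cs, x c = 1 := by
      rw [and_iff_right ht]
      refine forall₂_congr fun c hc => ?_
      rw [hx c (by rintro rfl; exact ht hc)]
    simp only [applyCtrl, hcond]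
    split_ifs
    · have h1 : ∀ b, Function.update x' t b = x ↔ b = x t := by
        intro b
        rw [hx', Function.update_idem]
        constructor
        · intro h; rw [← h, Function.update_self]
        · rintro rfl; exact Function.update_eq_self _ _
      have h2 : ∀ b, x' = Function.update x t b ↔ x' t = b := by
        intro b
        constructor
        · intro h; rw [h, Function.update_self]
        · rintro rfl; exact hx'
      simp only [Pi.single_apply, h1, Finset.sum_apply, Pi.smul_apply, smul_eq_mul, mul_ite,
        mul_one, mul_zero, h2, Finset.sum_ite_eq, Finset.sum_ite_eq', Finset.mem_univ, if_true]
    · rfl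
  · have h1 : ∀ b, Function.update x' t b ≠ x := by
      rintro b rfl
      exact hx fun s hs => by rw [Function.update_of_ne hs]
    have h2 : ∀ b, x' ≠ Function.update x t b := by
      rintro b rfl
      exact hx fun s hs => by rw [Function.update_of_ne hs]
    have h3 : x' ≠ x := by
      rintro rfl
      exact hx fun _ _ => rfl
    simp only [applyCtrl]
    split_ifs <;> simp [h1, h2, h3]

theorem applyCtrl_single_of_ne {W : Type} [Fintype W] [DecidableEq W] {cs : List W} {c t : W}
    (u : Matrix (ZMod 2) (ZMod 2) ℂ) {x : W → ZMod 2} (hc : c ∈ cs) (hxc : x c ≠ 1) :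
    applyCtrl cs u t (Pi.single x 1) = Pi.single x 1 := by
  by_cases ht : t ∈ cs
  · funext x'
    simp [applyCtrl, ht]
  · rw [applyCtrl_single ht, if_neg fun h => hxc (h c hc)]

theorem applyCtrl_X_single {W : Type} [Fintype W] [DecidableEq W] {cs : List W} {t : W}
    (ht : t ∉ cs) {x : W → ZMod 2} (hx : ∀ c ∈ cs, x c = 1) :
    applyCtrl cs OneQubit.X.mat t (Pi.single x 1) =
      Pi.single (Function.update x t (x t + 1)) 1 := by
  have h10 : (1 : ZMod 2) + 1 = 0 := rfl
  rw [applyCtrl_single ht, if_pos hx, sum_zmod_two]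
  rcases zmod_two_cases (x t) with h | h <;> simp [h, h10, OneQubit.mat, Pauli.mat]

/-- Multiplying by the norm avoids division and covers `a = b = 0`, where the rotation is the
identity and both sides vanish. Such branches of amplitude zero do occur in the preparation of the
pilot state. -/
theorem sqrt_smul_applyCtrl_rot_single {W : Type} [Fintype W] [DecidableEq W] {cs : List W} {t : W}
    (ht : t ∉ cs) {x : W → ZMod 2} (hx : ∀ c ∈ cs, x c = 1) (hxt : x t = 0) (a b : ℝ) :
    ((√(a ^ 2 + b ^ 2) : ℝ) : ℂ) • applyCtrl cs (OneQubit.rot a b).mat t (Pi.single x 1) =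
      (a : ℂ) • Pi.single x 1 + (b : ℂ) • Pi.single (Function.update x t 1) 1 := by
  have hx0 : Function.update x t 0 = x := by rw [← hxt, Function.update_eq_self]
  by_cases hab : a = 0 ∧ b = 0
  · simp [hab.1, hab.2]
  · have hpos : 0 < a ^ 2 + b ^ 2 := by
      rcases not_and_or.1 hab with h | h <;> positivity
    have hne : ((√(a ^ 2 + b ^ 2) : ℝ) : ℂ) ≠ 0 := by
      exact_mod_cast (Real.sqrt_pos.2 hpos).ne'
    have hmul : ∀ r : ℝ, ((√(a ^ 2 + b ^ 2) : ℝ) : ℂ) * ((r : ℂ) / ((√(a ^ 2 + b ^ 2) : ℝ) : ℂ)) =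
        r := fun r => mul_div_cancel₀ _ hne
    rw [applyCtrl_single ht, if_pos hx, sum_zmod_two, hxt, hx0, smul_add, smul_smul, smul_smul]
    simp only [OneQubit.mat, if_neg hab, Matrix.of_apply, Complex.ofReal_div, hmul]
    simp

/-! ### Preparation of the pilot state -/

section

variable {n m : ℕ}

/-- Content `y` of register `A`, and the number `k` in unary one-hot encoding in the ancillas. -/
def counterState (y : Fin m → ZMod 2) (k : Fin (m + 1)) : QState (Wire n m (m + 1)) :=
  Pi.single (Wire.bits y 0 (Pi.single k 1)) 1

/-- Rotate the `i`-th qubit of `A` if the counter holds `k`, and then increase a counter holding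
`k` by the value of that qubit. -/
def rotateAndCount (g : ℕ → ℕ → ℝ) (i k : Fin m) : List (Gate (Wire n m (m + 1)) ℝ) :=
  [.ctrl (.anc k.castSucc) (.rot (g (m - i - 1) k) (g (m - i - 1) (k + 1))) (.A i),
    .ctrl₂ (.A i) (.anc k.castSucc) .X (.anc k.succ),
    .ctrl₂ (.A i) (.anc k.succ) .X (.anc k.castSucc)]

/-- Decrease a counter holding `k + 1` by the value of the `i`-th qubit of `A`. -/
def uncount (i k : Fin m) : List (Gate (Wire n m (m + 1)) ℝ) :=
  [.ctrl₂ (.A i) (.anc k.succ) .X (.anc k.castSucc),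
    .ctrl₂ (.A i) (.anc k.castSucc) .X (.anc k.succ)]

/-- A circuit that prepares the pilot state. The rotation of the first ancilla is the global sign
of the state if `m = 0`, and trivial otherwise. -/
def pilotCircuit (n m : ℕ) (g : ℕ → ℕ → ℝ) : List (Gate (Wire n m (m + 1)) ℝ) :=
  [.single .X (.anc 0), .single (.rot (g m 0) 0) (.anc 0)] ++
    ((List.finRange m).flatMap fun i =>
      (List.finRange m).flatMap fun k => rotateAndCount g i k.rev) ++
    ((List.finRange m).flatMap fun i => (List.finRange m).flatMap fun k => uncount i k) ++
    [.single .X (.anc 0)]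

@[simp] theorem Wire.bits_A {a : ℕ} (y : Fin m → ZMod 2) (s : Fin n ⊕ Fin n → ZMod 2)
    (v : Fin a → ZMod 2) (i : Fin m) : Wire.bits y s v (.A i) = y i := rfl

@[simp] theorem Wire.bits_anc {a : ℕ} (y : Fin m → ZMod 2) (s : Fin n ⊕ Fin n → ZMod 2)
    (v : Fin a → ZMod 2) (k : Fin a) : Wire.bits y s v (.anc k) = v k := rfl

theorem Wire.update_bits_A {a : ℕ} (y : Fin m → ZMod 2) (s : Fin n ⊕ Fin n → ZMod 2)
    (v : Fin a → ZMod 2) (i : Fin m) (b : ZMod 2) :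
    Function.update (Wire.bits y s v) (.A i) b = Wire.bits (Function.update y i b) s v := by
  exact Sum.update_elim_inl

theorem Wire.update_bits_anc {a : ℕ} (y : Fin m → ZMod 2) (s : Fin n ⊕ Fin n → ZMod 2)
    (v : Fin a → ZMod 2) (k : Fin a) (b : ZMod 2) :
    Function.update (Wire.bits y s v) (.anc k) b = Wire.bits y s (Function.update v k b) := by
  rw [Wire.bits, Wire.anc, Sum.update_elim_inr, Sum.update_elim_inr, Wire.bits]

theorem applyCtrl_counterState_of_ne {cs : List (Wire n m (m + 1))} {k K : Fin (m + 1)}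
    {t : Wire n m (m + 1)} (u : Matrix (ZMod 2) (ZMod 2) ℂ) {y : Fin m → ZMod 2}
    (hk : .anc k ∈ cs) (hK : k ≠ K) :
    applyCtrl cs u t (counterState y K) = counterState y K :=
  applyCtrl_single_of_ne u hk (by simp [hK])

theorem applyCtrl_counterState_of_zero {cs : List (Wire n m (m + 1))} {K : Fin (m + 1)}
    {t : Wire n m (m + 1)} (u : Matrix (ZMod 2) (ZMod 2) ℂ) {y : Fin m → ZMod 2} {i : Fin m}
    (hi : .A i ∈ cs) (hy : y i = 0) :
    applyCtrl cs u t (counterState y K) = counterState y K :=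
  applyCtrl_single_of_ne u hi (by simp [hy])

/-- Two controlled gates that move the number in the counter. -/
theorem applyCtrl_move_counterState {y : Fin m → ZMod 2} {i : Fin m} (hy : y i = 1)
    {k K : Fin (m + 1)} (hk : k ≠ K) :
    applyCtrl [.A i, .anc k] OneQubit.X.mat (.anc K)
        (applyCtrl [.A i, .anc K] OneQubit.X.mat (.anc k) (counterState (n := n) y K)) =
      counterState y k := by
  have h10 : (1 : ZMod 2) + 1 = 0 := rfl
  rw [counterState, applyCtrl_X_single (W := Wire n m (m + 1)) (cs := [.A i, .anc K])
      (by simp [hk]) (by simp [hy]), Wire.update_bits_anc,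
    applyCtrl_X_single (W := Wire n m (m + 1)) (cs := [.A i, .anc k])
      (by simp [hk.symm]) (by simp [hy, hk]), Wire.update_bits_anc, counterState]
  congr 2
  funext j
  by_cases hj : j = K
  · subst hj; simp [hk, hk.symm, h10]
  · by_cases hj' : j = k
    · subst hj'; simp [hj]
    · simp [hj, hj']

theorem applyGates_flatMap_fixed {W ι : Type} [DecidableEq W] {G : ι → List (Gate W ℝ)}
    {ψ : QState W} {L : List ι} (h : ∀ k ∈ L, applyGates (G k) ψ = ψ) :
    applyGates (L.flatMap G) ψ = ψ := by
  induction L with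
  | nil => rfl
  | cons k L ih =>
    rw [List.flatMap_cons, applyGates_append, h k (by simp), ih fun j hj => h j (by simp [hj])]

/-- Splits a loop over the counter values into the rounds before, at and after the only round that
acts. -/
theorem finRange_eq_append (k : Fin m) :
    ∃ L₁ L₂ : List (Fin m), List.finRange m = L₁ ++ k :: L₂ ∧ (∀ j ∈ L₁, j < k) ∧
      ∀ j ∈ L₂, k < j := by
  obtain ⟨L₁, L₂, h⟩ := List.append_of_mem (List.mem_finRange k)
  have hsort : (List.finRange m).Pairwise (· < ·) := List.pairwise_lt_finRange m
  rw [h, List.pairwise_append, List.pairwise_cons] at hsort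
  exact ⟨L₁, L₂, h, fun j hj => hsort.2.2 j hj k (by simp), fun j hj => hsort.2.1.1 j hj⟩

/-- Only the round `K` acts on a counter holding `K`. The loop runs downwards, so a counter just
raised to `K + 1` is met only by rounds below `K`, which do not touch it; in upward order it would
be rotated and counted again. The factor in front is the norm of the two branches, as in
`sqrt_smul_applyCtrl_rot_single`. -/
theorem applyGates_rotateAndCount_loop (g : ℕ → ℕ → ℝ) {y : Fin m → ZMod 2} {i : Fin m}
    (hy : y i = 0) (K : Fin m) :
    ((√(g (m - i - 1) K ^ 2 + g (m - i - 1) (K + 1) ^ 2) : ℝ) : ℂ) •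
        applyGates ((List.finRange m).flatMap fun k => rotateAndCount g i k.rev)
          (counterState (n := n) y K.castSucc) =
      (g (m - i - 1) K : ℂ) • counterState y K.castSucc +
        (g (m - i - 1) (K + 1) : ℂ) • counterState (Function.update y i 1) K.succ := by
  obtain ⟨L₁, L₂, hL, h₁, h₂⟩ := finRange_eq_append K.rev
  have hbefore : ∀ k ∈ L₁, applyGates (rotateAndCount g i k.rev)
      (counterState (n := n) y K.castSucc) = counterState y K.castSucc := by
    intro k hk
    have hne : k.rev ≠ K := by rintro rfl; simpa using h₁ k hk
    simp only [rotateAndCount, applyGates_cons, applyGates_nil, Gate.apply]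
    rw [applyCtrl_counterState_of_ne (k := k.rev.castSucc) _ List.mem_cons_self
        (by simpa using hne),
      applyCtrl_counterState_of_zero _ (i := i) List.mem_cons_self hy,
      applyCtrl_counterState_of_zero _ (i := i) List.mem_cons_self hy]
  have hafter : ∀ k ∈ L₂, applyGates (rotateAndCount g i k.rev)
      (counterState (n := n) y K.castSucc) = counterState y K.castSucc := by
    intro k hk
    have hne : k.rev ≠ K := by rintro rfl; simpa using h₂ k hk
    simp only [rotateAndCount, applyGates_cons, applyGates_nil, Gate.apply]
    rw [applyCtrl_counterState_of_ne (k := k.rev.castSucc) _ List.mem_cons_self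
        (by simpa using hne),
      applyCtrl_counterState_of_zero _ (i := i) List.mem_cons_self hy,
      applyCtrl_counterState_of_zero _ (i := i) List.mem_cons_self hy]
  have hafter' : ∀ k ∈ L₂, applyGates (rotateAndCount g i k.rev)
      (counterState (n := n) (Function.update y i 1) K.succ) =
        counterState (Function.update y i 1) K.succ := by
    intro k hk
    have hlt : k.rev < K := by rw [← Fin.rev_lt_rev, Fin.rev_rev]; exact h₂ k hk
    have hne : k.rev.succ ≠ K.succ := by simpa using hlt.ne
    have hne' : k.rev.castSucc ≠ K.succ := by
      rw [Fin.lt_def] at hlt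
      rw [Ne, Fin.ext_iff, Fin.val_castSucc, Fin.val_succ]
      omega
    simp only [rotateAndCount, applyGates_cons, applyGates_nil, Gate.apply]
    rw [applyCtrl_counterState_of_ne (k := k.rev.castSucc) _ List.mem_cons_self hne',
      applyCtrl_counterState_of_ne (k := k.rev.castSucc) _
        (List.mem_cons_of_mem _ List.mem_cons_self) hne',
      applyCtrl_counterState_of_ne (k := k.rev.succ) _
        (List.mem_cons_of_mem _ List.mem_cons_self) hne]
  have hrot := sqrt_smul_applyCtrl_rot_single (W := Wire n m (m + 1))
    (cs := [.anc K.castSucc]) (t := .A i) (x := Wire.bits y 0 (Pi.single K.castSucc 1)) (by simp)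
    (by simp) (by simpa using hy) (g (m - i - 1) K) (g (m - i - 1) (K + 1))
  rw [Wire.update_bits_A] at hrot
  change _ = _ • counterState _ _ + _ • counterState _ _ at hrot
  change _ • applyCtrl _ _ _ (counterState _ _) = _ at hrot
  have hstep : ((√(g (m - i - 1) K ^ 2 + g (m - i - 1) (K + 1) ^ 2) : ℝ) : ℂ) •
        applyGates (rotateAndCount g i K) (counterState (n := n) y K.castSucc) =
      (g (m - i - 1) K : ℂ) • counterState y K.castSucc +
        (g (m - i - 1) (K + 1) : ℂ) • counterState (Function.update y i 1) K.succ := by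
    simp only [rotateAndCount, applyGates_cons, applyGates_nil, Gate.apply]
    rw [← (isLinearMap_applyCtrl _ _ _).map_smul, ← (isLinearMap_applyCtrl _ _ _).map_smul, hrot]
    simp only [(isLinearMap_applyCtrl _ _ _).map_add, (isLinearMap_applyCtrl _ _ _).map_smul]
    rw [applyCtrl_counterState_of_zero _ (i := i) List.mem_cons_self hy,
      applyCtrl_counterState_of_zero _ (i := i) List.mem_cons_self hy,
      applyCtrl_move_counterState (by simp) (by simp [Fin.ext_iff])]
  rw [hL, List.flatMap_append, List.flatMap_cons, applyGates_append, applyGates_append,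
    applyGates_flatMap_fixed hbefore, Fin.rev_rev, ← (isLinearMap_applyGates _).map_smul, hstep,
    (isLinearMap_applyGates _).map_add, (isLinearMap_applyGates _).map_smul,
    (isLinearMap_applyGates _).map_smul, applyGates_flatMap_fixed hafter,
    applyGates_flatMap_fixed hafter']

theorem applyGates_uncount_loop_of_zero {y : Fin m → ZMod 2} {i : Fin m} (hy : y i = 0)
    (K : Fin (m + 1)) :
    applyGates ((List.finRange m).flatMap fun k => uncount i k) (counterState (n := n) y K) =
      counterState y K := by
  refine applyGates_flatMap_fixed fun k _ => ?_
  simp only [uncount, applyGates_cons, applyGates_nil, Gate.apply]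
  rw [applyCtrl_counterState_of_zero _ (i := i) List.mem_cons_self hy,
    applyCtrl_counterState_of_zero _ (i := i) List.mem_cons_self hy]

/-- Here the loop runs upwards: a counter lowered to `K` is not touched by the later rounds `k > K`.
-/
theorem applyGates_uncount_loop_of_one {y : Fin m → ZMod 2} {i : Fin m} (hy : y i = 1)
    (K : Fin m) :
    applyGates ((List.finRange m).flatMap fun k => uncount i k)
        (counterState (n := n) y K.succ) = counterState y K.castSucc := by
  obtain ⟨L₁, L₂, hL, h₁, h₂⟩ := finRange_eq_append K
  have hbefore : ∀ k ∈ L₁, applyGates (uncount i k)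
      (counterState (n := n) y K.succ) = counterState y K.succ := by
    intro k hk
    have hlt := Fin.lt_def.1 (h₁ k hk)
    simp only [uncount, applyGates_cons, applyGates_nil, Gate.apply]
    rw [applyCtrl_counterState_of_ne (k := k.succ) _ (List.mem_cons_of_mem _ List.mem_cons_self)
        (by simp [Fin.ext_iff]; omega),
      applyCtrl_counterState_of_ne (k := k.castSucc) _ (List.mem_cons_of_mem _ List.mem_cons_self)
        (by simp [Fin.ext_iff]; omega)]
  have hafter : ∀ k ∈ L₂, applyGates (uncount i k)
      (counterState (n := n) y K.castSucc) = counterState y K.castSucc := by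
    intro k hk
    have hlt := Fin.lt_def.1 (h₂ k hk)
    simp only [uncount, applyGates_cons, applyGates_nil, Gate.apply]
    rw [applyCtrl_counterState_of_ne (k := k.succ) _ (List.mem_cons_of_mem _ List.mem_cons_self)
        (by simp [Fin.ext_iff]; omega),
      applyCtrl_counterState_of_ne (k := k.castSucc) _ (List.mem_cons_of_mem _ List.mem_cons_self)
        (by simp [Fin.ext_iff]; omega)]
  have hstep : applyGates (uncount i K) (counterState (n := n) y K.succ) =
      counterState y K.castSucc := by
    simp only [uncount, applyGates_cons, applyGates_nil, Gate.apply]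
    rw [applyCtrl_move_counterState hy (by simp [Fin.ext_iff])]
  rw [hL, List.flatMap_append, List.flatMap_cons, applyGates_append, applyGates_append,
    applyGates_flatMap_fixed hbefore, hstep, applyGates_flatMap_fixed hafter]

/-- The invariant is that the counter holds the number of ones among the qubits still to be
processed. -/
theorem applyGates_uncount (y : Fin m → ZMod 2) (L : List (Fin m)) (K : Fin (m + 1))
    (hK : (K : ℕ) = L.countP fun i => y i = 1) :
    applyGates (L.flatMap fun i => (List.finRange m).flatMap fun k => uncount i k)
        (counterState (n := n) y K) = counterState y 0 := by
  induction L generalizing K with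
  | nil =>
    have : K = 0 := Fin.ext hK
    simp [this]
  | cons i L ih =>
    rw [List.flatMap_cons, applyGates_append]
    rcases zmod_two_cases (y i) with hy | hy
    · rw [applyGates_uncount_loop_of_zero hy, ih]
      rw [hK, List.countP_cons_of_neg (by simp [hy])]
    · rw [List.countP_cons_of_pos (by simp [hy])] at hK
      obtain ⟨K, rfl⟩ : ∃ K' : Fin m, K = K'.succ :=
        Fin.exists_succ_eq.2 (by rintro rfl; simp at hK) |>.imp fun _ h => h.symm
      rw [applyGates_uncount_loop_of_one hy, ih]
      simpa using hK

/-- The Hamming weight of a string, as a value of the counter. -/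
def weight (y : Fin m → ZMod 2) : Fin (m + 1) :=
  ⟨hammingNorm y, Nat.lt_succ_of_le (hammingNorm_le y)⟩

theorem countP_finRange_eq_hammingNorm (y : Fin m → ZMod 2) :
    (List.finRange m).countP (fun i => y i = 1) = hammingNorm y := by
  have h : (Finset.univ.filter fun i => y i ≠ 0) =
      ((List.finRange m).filter fun i => y i = 1).toFinset := by
    ext i
    rcases zmod_two_cases (y i) with h | h <;> simp [h]
  rw [hammingNorm, h, List.toFinset_card_of_nodup ((List.nodup_finRange m).filter _),
    List.countP_eq_length_filter]

theorem hammingNorm_update_one {y : Fin m → ZMod 2} {i : Fin m} (hy : y i = 0) :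
    hammingNorm (Function.update y i 1) = hammingNorm y + 1 := by
  have h : Function.update y i 1 = y + Pi.single i 1 := by
    funext k
    by_cases hk : k = i
    · subst hk; simp [hy]
    · simp [hk]
  rw [h, hammingNorm_add_single, if_neg (by simp [hy])]

theorem hammingNorm_lt_of_eq_zero {y : Fin m → ZMod 2} {i : Fin m} (hy : y i = 0) :
    hammingNorm y < m := by
  have := hammingNorm_le (Function.update y i 1)
  rw [hammingNorm_update_one hy] at this
  omega

/-- A string supported on the first `i + 1` bits is one supported on the first `i` bits, with bit
`i` left at `0` or set to `1`. -/
theorem sum_filter_succ {E : Type*} [AddCommMonoid E] (i : Fin m) (f : (Fin m → ZMod 2) → E) :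
    ∑ y with ∀ j : Fin m, (i : ℕ) + 1 ≤ j → y j = 0, f y =
      ∑ y with ∀ j : Fin m, (i : ℕ) ≤ j → y j = 0, (f y + f (Function.update y i 1)) := by
  rw [Finset.sum_add_distrib, ← Finset.sum_filter_add_sum_filter_not _ (fun y => y i = 0)]
  congr 1
  · rw [Finset.filter_filter]
    refine Finset.sum_congr (Finset.filter_congr fun y _ => ?_) fun _ _ => rfl
    constructor
    · rintro ⟨h, h0⟩ j hj
      rcases hj.eq_or_lt with hj | hj
      · rwa [← Fin.ext hj]
      · exact h j hj
    · exact fun h => ⟨fun j hj => h j (by omega), h i le_rfl⟩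
  · rw [Finset.filter_filter]
    symm
    refine Finset.sum_bij (fun y _ => Function.update y i 1) ?_ ?_ ?_ fun _ _ => rfl
    · intro y hy
      simp only [Finset.mem_filter, Finset.mem_univ, true_and] at hy ⊢
      refine ⟨fun j hj => ?_, by simp⟩
      rw [Function.update_of_ne (by rintro rfl; omega)]
      exact hy j (by omega)
    · intro y hy y' hy' h
      simp only [Finset.mem_filter, Finset.mem_univ, true_and] at hy hy'
      funext j
      by_cases hj : j = i
      · rw [hj, hy i le_rfl, hy' i le_rfl]
      · simpa [hj] using congrFun h j
    · intro y hy
      simp only [Finset.mem_filter, Finset.mem_univ, true_and] at hy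
      have h1 : y i = 1 := (zmod_two_cases _).resolve_left hy.2
      refine ⟨Function.update y i 0, ?_,
        by rw [Function.update_idem, ← h1, Function.update_eq_self]⟩
      simp only [Finset.mem_filter, Finset.mem_univ, true_and]
      intro j hj
      by_cases hji : j = i
      · simp [hji]
      · rw [Function.update_of_ne hji]
        exact hy.1 j (by
          rcases hj.eq_or_lt with h | h
          · exact absurd (Fin.ext h).symm hji
          · exact h)

/-- The invariant after `i` qubits: the counter holds the weight of the prefix, and the amplitude
is, up to `c`, the norm `g (m - i) |y|` of all completions of that prefix. The next rotation splits
it into the norms of the completions through `0` and through `1`. In the last row the norms are the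
amplitudes themselves, with sign. -/
theorem applyGates_rotateAndCount {w : ℕ → ℝ} {g : ℕ → ℕ → ℝ} (hg : IsRotationTable m w g)
    (c : ℂ) (i : ℕ) (hi : i ≤ m) :
    applyGates (((List.finRange m).take i).flatMap fun i =>
        (List.finRange m).flatMap fun k => rotateAndCount g i k.rev)
        ((g m 0 * c : ℂ) • counterState (n := n) 0 0) =
      ∑ y : Fin m → ZMod 2 with ∀ j : Fin m, i ≤ j → y j = 0,
        (g (m - i) (hammingNorm y) * c : ℂ) • counterState y (weight y) := by
  induction i with
  | zero =>
    have h0 : (Finset.univ.filter fun y : Fin m → ZMod 2 => ∀ j : Fin m, 0 ≤ (j : ℕ) → y j = 0) =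
        {0} := by
      ext y
      simp [funext_iff]
    rw [h0]
    simp [weight]
  | succ i ih =>
    have hget : (List.finRange m).take (i + 1) = (List.finRange m).take i ++ [⟨i, hi⟩] := by
      rw [List.take_add_one, List.getElem?_eq_getElem (by simpa using hi)]
      simp
    rw [hget, List.flatMap_append, applyGates_append, ih (by omega),
      IsLinearMap.map_sum_smul (isLinearMap_applyGates _),
      sum_filter_succ (⟨i, hi⟩ : Fin m)]
    refine Finset.sum_congr rfl fun y hy => ?_
    have hyi : y ⟨i, hi⟩ = 0 := (Finset.mem_filter.1 hy).2 _ le_rfl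
    have hlt := hammingNorm_lt_of_eq_zero hyi
    have hloop := applyGates_rotateAndCount_loop (n := n) g hyi ⟨hammingNorm y, hlt⟩
    -- The recurrence of `g` turns the current amplitude into the norm that `hloop` carries as its
    -- factor.
    rw [List.flatMap_singleton, show m - i = m - i - 1 + 1 by omega,
      hg.succ (m - i - 1) (by omega) _ hlt, mul_comm, mul_smul]
    rw [show weight y = (⟨hammingNorm y, hlt⟩ : Fin m).castSucc from rfl, hloop,
      hammingNorm_update_one hyi,
      show weight (Function.update y ⟨i, hi⟩ 1) = (⟨hammingNorm y, hlt⟩ : Fin m).succ from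
        Fin.ext (by simp [weight, hammingNorm_update_one hyi]),
      smul_add, smul_smul, smul_smul, mul_comm c, mul_comm c]
    rfl

theorem applyGates_pilotCircuit {l : ℕ} {w : ℕ → ℝ} {g : ℕ → ℕ → ℝ} (hg : IsRotationTable m w g)
    (hl : l ≤ m) (hw : ∀ k, l < k → k ≤ m → w k = 0) (hw0 : ∃ k ≤ l, w k ≠ 0) :
    applyGates (pilotCircuit n m g) (zeroState _) = pilotState n m (m + 1) l w := by
  have hN := hg.sqrt_eq_abs hl hw
  have hpos : 0 < |g m 0| := by
    rw [← hN]
    obtain ⟨k, hk, hwk⟩ := hw0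
    refine Real.sqrt_pos.2 (Finset.sum_pos' (fun j _ => by positivity) ⟨k, by simp; omega, ?_⟩)
    have := Nat.choose_pos (hk.trans hl)
    positivity
  have hzero : (zeroState (Wire n m (m + 1))) = Pi.single (Wire.bits 0 0 0) 1 := by
    rw [zeroState]
    congr 1
    funext r
    rcases r with r | r | r <;> rfl
  have hX : ∀ y : Fin m → ZMod 2, (Gate.single OneQubit.X (.anc 0)).apply
      (Pi.single (Wire.bits y 0 0) 1 : QState (Wire n m (m + 1))) = counterState y 0 := by
    intro y
    rw [Gate.apply, applyCtrl_X_single (cs := []) (by simp) (by simp),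
      Wire.update_bits_anc, counterState]
    simp [Pi.single]
  have hupd : ∀ b, Function.update (Pi.single 0 1 : Fin (m + 1) → ZMod 2) 0 b =
      Pi.single 0 b := fun b => by rw [Pi.single, Function.update_idem, Pi.single]
  have hX' : ∀ y : Fin m → ZMod 2, (Gate.single OneQubit.X (.anc 0)).apply
      (counterState (n := n) y 0) = Pi.single (Wire.bits y 0 0) 1 := by
    intro y
    rw [counterState, Gate.apply, applyCtrl_X_single (cs := []) (by simp) (by simp),
      Wire.update_bits_anc, hupd]
    simp [show (1 : ZMod 2) + 1 = 0 from rfl]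
  -- The rotation `rot a 0` is the scalar `a / |a|`; with `c = 1 / |g m 0|` below, this gives the
  -- initial amplitude `g m 0 * c`.
  have hrot : (Gate.single (OneQubit.rot (g m 0) 0) (.anc 0)).apply
      (counterState (n := n) (m := m) 0 0) =
        (g m 0 * ((|g m 0|)⁻¹ : ℝ) : ℂ) • counterState 0 0 := by
    rw [counterState, Gate.apply, applyCtrl_single (cs := []) (by simp), if_pos (by simp),
      sum_zmod_two]
    rw [Wire.update_bits_anc, Wire.update_bits_anc, hupd, hupd]
    have hne : g m 0 ≠ 0 := abs_pos.1 hpos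
    simp [OneQubit.mat, hne, Real.sqrt_sq_eq_abs, div_eq_mul_inv]
  have hrotate := applyGates_rotateAndCount (n := n) hg ((|g m 0|)⁻¹ : ℝ) m le_rfl
  rw [List.take_of_length_le (by simp)] at hrotate
  rw [pilotCircuit, applyGates_append, applyGates_append, applyGates_append, hzero]
  simp only [applyGates_cons, applyGates_nil]
  rw [hX, hrot, hrotate,
    Finset.filter_true_of_mem fun y _ j hj => by omega,
    IsLinearMap.map_sum_smul (isLinearMap_applyGates _),
    IsLinearMap.map_sum_smul (Gate.isLinearMap_apply _), pilotState_eq_sum, hN]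
  refine Finset.sum_congr rfl fun y _ => ?_
  rw [applyGates_uncount y _ _ (countP_finRange_eq_hammingNorm y).symm, hX',
    Nat.sub_self, hg.zero _ (hammingNorm_le y), mul_comm]
  congr 1
  push_cast
  split_ifs with hy
  · rfl
  · rw [hw _ (by omega) (hammingNorm_le y)]

end

/-! ### Verification of programs -/

/-- From `s` the machine goes to `t` in at most `T` steps, applying the quantum steps `L`; the
counters below `b` and the array `9` are as before. -/
structure Reaches (b : ℕ) (s t : Config) (L : List (QStep (Register × ℕ) ℝ)) (T : ℕ) : Prop where
  ctr : ∀ x < b, t.ctr x = s.ctr x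
  circuit : t.circuit = s.circuit ++ L
  zero : t.mem 9 = s.mem 9
  time : t.time ≤ s.time + T

theorem Reaches.trans {b : ℕ} {s t u : Config} {L L' : List (QStep (Register × ℕ) ℝ)} {T T' : ℕ}
    (h : Reaches b s t L T) (h' : Reaches b t u L' T') : Reaches b s u (L ++ L') (T + T') where
  ctr x hx := (h'.ctr x hx).trans (h.ctr x hx)
  circuit := by rw [h'.circuit, h.circuit, List.append_assoc]
  zero := h'.zero.trans h.zero
  time := by have := h.time; have := h'.time; omega

theorem Reaches.mono {b b' : ℕ} {s t : Config} {L : List (QStep (Register × ℕ) ℝ)} {T T' : ℕ}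
    (h : Reaches b s t L T) (hb : b' ≤ b) (hT : T ≤ T') : Reaches b' s t L T' where
  ctr x hx := h.ctr x (hx.trans_le hb)
  circuit := h.circuit
  zero := h.zero
  time := h.time.trans (by omega)

theorem flatMap_const_nil {α β : Type*} (l : List α) :
    l.flatMap (fun _ => ([] : List β)) = [] := by
  induction l with
  | nil => rfl
  | cons a l ih => rw [List.flatMap_cons, ih, List.append_nil]

/-- The loop rule, with an invariant `Q` on the real memory. -/
theorem Reaches.loop {inp : Input} {b x y T : ℕ} {p : Program} {s : Config}
    {L : ℕ → List (QStep (Register × ℕ) ℝ)} (hb : b ≤ x) (Q : ℕ → (ℕ → ℕ → ℕ → ℝ) → Prop)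
    (h0 : Q 0 s.mem)
    (hs : ∀ i < s.ctr y, ∀ t : Config, (∀ z < b, t.ctr z = s.ctr z) → t.ctr x = i →
      t.mem 9 = s.mem 9 → Q i t.mem →
        Reaches b t (p.exec inp t) (L i) T ∧ Q (i + 1) (p.exec inp t).mem) :
    Reaches b s ((Program.loop x y p).exec inp s) ((List.range (s.ctr y)).flatMap L)
        (1 + s.ctr y * (T + 1)) ∧
      Q (s.ctr y) ((Program.loop x y p).exec inp s).mem := by
  rw [Program.exec]
  have key : ∀ N ≤ s.ctr y,
      Reaches b s ((List.range N).foldl (fun t i => p.exec inp (t.setCtr x i).tick) s.tick)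
          ((List.range N).flatMap L) (1 + N * (T + 1)) ∧
        Q N ((List.range N).foldl (fun t i => p.exec inp (t.setCtr x i).tick) s.tick).mem := by
    intro N
    induction N with
    | zero =>
      intro _
      exact ⟨⟨fun _ _ => rfl, by simp [Config.tick], rfl, by simp [Config.tick]⟩, h0⟩
    | succ N ih =>
      intro hN
      obtain ⟨h1, h2⟩ := ih (by omega)
      rw [List.range_succ, List.foldl_append, List.flatMap_append, List.flatMap_singleton,
        List.foldl_cons, List.foldl_nil]
      set t := (List.range N).foldl (fun t i => p.exec inp (t.setCtr x i).tick) s.tick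
      -- The loop counter is written afresh in every round, so the body has to preserve only the
      -- counters below `b ≤ x`.
      have hset : Reaches b t (t.setCtr x N).tick [] 1 :=
        ⟨fun z hz => Function.update_of_ne (by omega) _ _, by simp [Config.tick, Config.setCtr],
          rfl, le_rfl⟩
      have hst := h1.trans hset
      obtain ⟨h3, h4⟩ := hs N (by omega) (t.setCtr x N).tick (fun z hz => hst.ctr z hz)
        (Function.update_self _ _ _) hst.zero h2
      refine ⟨?_, h4⟩
      have := (hst.trans h3).mono le_rfl (T' := 1 + (N + 1) * (T + 1)) (by ring_nf; omega)
      simpa using this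
  exact key _ le_rfl

/-- A list of programs, run one after the other. -/
def Program.block (p : Program) : List Program → Program
  | [] => p
  | q :: qs => .seq p (block q qs)

@[simp] theorem Program.exec_block_nil (inp : Input) (p : Program) (s : Config) :
    (Program.block p []).exec inp s = p.exec inp s := rfl

@[simp] theorem Program.exec_block_cons (inp : Input) (p q : Program) (qs : List Program)
    (s : Config) : (Program.block p (q :: qs)).exec inp s =
      (Program.block q qs).exec inp (p.exec inp s) := rfl

/-- The counters of the configuration `s` are set up for the main part of the program. -/
structure IsReady (inp : Input) (s : Config) : Prop where
  n : s.ctr 0 = inp.n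
  m : s.ctr 1 = inp.m
  l : s.ctr 2 = inp.l
  one : s.ctr 3 = 1
  l_succ : s.ctr 4 = inp.l + 1
  m_succ : s.ctr 5 = inp.m + 1
  zero : s.ctr 6 = 0
  mem_zero : s.mem 9 = 0

theorem IsReady.of_eq {inp : Input} {b : ℕ} {s t : Config} (h : IsReady inp s) (hb : 7 ≤ b)
    (hctr : ∀ x < b, t.ctr x = s.ctr x) (hmem : t.mem 9 = s.mem 9) : IsReady inp t :=
  ⟨(hctr 0 (by omega)).trans h.n, (hctr 1 (by omega)).trans h.m, (hctr 2 (by omega)).trans h.l,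
    (hctr 3 (by omega)).trans h.one, (hctr 4 (by omega)).trans h.l_succ,
    (hctr 5 (by omega)).trans h.m_succ, (hctr 6 (by omega)).trans h.zero, hmem.trans h.mem_zero⟩

theorem IsReady.of_reaches {inp : Input} {s t : Config} {L : List (QStep (Register × ℕ) ℝ)}
    {T : ℕ} (h : IsReady inp s) (hst : Reaches 7 s t L T) : IsReady inp t :=
  h.of_eq le_rfl hst.ctr hst.zero

/-! ### The classical part of the program -/

/-- Set up the constants `1`, `l + 1`, `m + 1`. -/
def initProgram : Program := .block (.set 3 1) [.add 4 2 3, .add 5 1 3]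

/-- One entry of the Horner table, computed in array `0`. -/
def hornerEntry : Program :=
  .block (.add 11 10 3)
    [.add 12 11 3, .sub 13 1 10, .cast ⟨2, 6, 6⟩ 10, .rmul ⟨2, 6, 6⟩ ⟨2, 6, 6⟩ ⟨0, 7, 10⟩,
      .cast ⟨3, 6, 6⟩ 13, .rmul ⟨3, 6, 6⟩ ⟨3, 6, 6⟩ ⟨0, 7, 12⟩,
      .radd ⟨2, 6, 6⟩ ⟨2, 6, 6⟩ ⟨3, 6, 6⟩,
      .ifZero 10 (.readCoeff ⟨3, 6, 6⟩ 9) (.rsub ⟨3, 6, 6⟩ ⟨3, 6, 6⟩ ⟨3, 6, 6⟩),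
      .radd ⟨0, 8, 11⟩ ⟨2, 6, 6⟩ ⟨3, 6, 6⟩]

/-- The coefficients of the expansion into elementary symmetric polynomials. -/
def hornerProgram : Program :=
  .loop 7 4 (.block (.add 8 7 3) [.sub 9 2 7, .loop 10 5 hornerEntry])

/-- The first row of the table of rotation parameters, in array `1`. -/
def copyProgram : Program :=
  .loop 7 5 (.block (.add 8 7 3) [.radd ⟨1, 6, 7⟩ ⟨0, 4, 8⟩ ⟨9, 6, 6⟩])

/-- One entry of the table of rotation parameters. -/
def rotationEntry : Program :=
  .block (.add 10 9 3)
    [.rmul ⟨2, 6, 6⟩ ⟨1, 7, 9⟩ ⟨1, 7, 9⟩, .rmul ⟨3, 6, 6⟩ ⟨1, 7, 10⟩ ⟨1, 7, 10⟩,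
      .radd ⟨2, 6, 6⟩ ⟨2, 6, 6⟩ ⟨3, 6, 6⟩, .rsqrt ⟨1, 8, 9⟩ ⟨2, 6, 6⟩]

/-- The table of rotation parameters, in array `1`. -/
def rotationProgram : Program :=
  .loop 7 1 (.block (.add 8 7 3) [.loop 9 1 rotationEntry])

/-- The recurrence of a Horner table for the first `τ` rows and the first `J` entries of the next
row. -/
structure IsPartialHornerTable (m l : ℕ) (c : ℕ → ℝ) (τ J : ℕ) (V : ℕ → ℕ → ℝ) : Prop where
  row_zero : ∀ j, V 0 j = 0
  col_zero : ∀ t, V t 0 = 0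
  succ : ∀ t j, t < τ ∨ t = τ ∧ j < J → j ≤ m → V (t + 1) (j + 1) =
    j * V t j + ((m - j : ℕ) : ℝ) * V t (j + 2) + if j = 0 then c (l - t) else 0

/-- The new entry lies in row `τ + 1`, whereas the recurrences established so far, like the new one,
read only rows up to `τ`. -/
theorem IsPartialHornerTable.step {m l : ℕ} {c : ℕ → ℝ} {τ J : ℕ} {V V' : ℕ → ℕ → ℝ}
    (h : IsPartialHornerTable m l c τ J V)
    (hV : ∀ r k, V' r k = if r = τ + 1 ∧ k = J + 1 then
      J * V τ J + ((m - J : ℕ) : ℝ) * V τ (J + 2) + (if J = 0 then c (l - τ) else 0)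
      else V r k) : IsPartialHornerTable m l c τ (J + 1) V' where
  row_zero j := by rw [hV, if_neg (by omega), h.row_zero]
  col_zero t := by rw [hV, if_neg (by omega), h.col_zero]
  succ t j htj hj := by
    rw [hV t j, if_neg (by omega), hV t (j + 2), if_neg (by omega), hV]
    by_cases h1 : t + 1 = τ + 1 ∧ j + 1 = J + 1
    · rw [if_pos h1]
      obtain ⟨rfl, rfl⟩ : t = τ ∧ j = J := by omega
      rfl
    · rw [if_neg h1, h.succ t j (by omega) hj]

theorem reaches_hornerEntry {inp : Input} {t : Config} (h : IsReady inp t) {τ J : ℕ}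
    (h7 : t.ctr 7 = τ) (h8 : t.ctr 8 = τ + 1) (h9 : t.ctr 9 = inp.l - τ) (h10 : t.ctr 10 = J)
    (hV : IsPartialHornerTable inp.m inp.l inp.coeff τ J (t.mem 0)) :
    Reaches 10 t (hornerEntry.exec inp t) [] 11 ∧
      IsPartialHornerTable inp.m inp.l inp.coeff τ (J + 1) ((hornerEntry.exec inp t).mem 0) := by
  have h6 := h.zero
  have h1 := h.m
  have h3 := h.one
  -- The branch of `.ifZero`: for `J ≠ 0` the added constant is `0`, obtained as the difference of a
  -- cell with itself.
  by_cases hJ : J = 0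
  · refine ⟨⟨fun x hx => ?_, ?_, ?_, ?_⟩, hV.step fun r k => ?_⟩ <;>
    simp [hornerEntry, Program.exec, Config.tick, Config.setCtr, Config.put, Config.get,
      Function.update_apply, h1, h3, h6, h7, h8, h9, h10, hJ]
    split_ifs <;> omega
  · refine ⟨⟨fun x hx => ?_, ?_, ?_, ?_⟩, hV.step fun r k => ?_⟩ <;>
    simp [hornerEntry, Program.exec, Config.tick, Config.setCtr, Config.put, Config.get,
      Function.update_apply, h1, h3, h6, h7, h8, h10, hJ]
    split_ifs <;> omega

theorem reaches_hornerProgram {inp : Input} {s : Config} (h : IsReady inp s) (h0 : s.mem 0 = 0) :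
    Reaches 7 s (hornerProgram.exec inp s) []
        (1 + (inp.l + 1) * (2 + (1 + (inp.m + 1) * (11 + 1)) + 1)) ∧
      IsHornerTable inp.m inp.l inp.coeff ((hornerProgram.exec inp s).mem 0) := by
  have key := Reaches.loop (inp := inp) (b := 7) (x := 7) (y := 4) (s := s) (L := fun _ => [])
    (T := 2 + (1 + (inp.m + 1) * (11 + 1)))
    (p := .block (.add 8 7 3) [.sub 9 2 7, .loop 10 5 hornerEntry]) le_rfl
    (fun τ V => IsPartialHornerTable inp.m inp.l inp.coeff τ 0 (V 0))
    ⟨fun j => by simp [h0], fun j => by simp [h0], by omega⟩ (by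
      intro τ hτ t hctr h7 hmem hV
      have ht := h.of_eq le_rfl hctr hmem
      rw [Program.exec_block_cons, Program.exec_block_cons, Program.exec_block_nil]
      set u := (Program.sub 9 2 7).exec inp ((Program.add 8 7 3).exec inp t) with hu
      have htu : Reaches 8 t u [] 2 := by
        refine ⟨fun x hx => ?_, ?_, ?_, ?_⟩ <;>
          simp [hu, Program.exec, Config.tick, Config.setCtr, Function.update_apply]
        split_ifs <;> omega
      have hu8 : u.ctr 8 = τ + 1 := by
        simp [hu, Program.exec, Config.tick, Config.setCtr, h7, ht.one]
      have hu9 : u.ctr 9 = inp.l - τ := by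
        simp [hu, Program.exec, Config.tick, Config.setCtr, h7, ht.l]
      have hru := ht.of_eq (by norm_num) htu.ctr htu.zero
      have hloop := Reaches.loop (inp := inp) (b := 10) (x := 10) (y := 5) (s := u)
        (L := fun _ => []) (T := 11) (p := hornerEntry) le_rfl
        (fun J V => IsPartialHornerTable inp.m inp.l inp.coeff τ J (V 0)) hV (by
          intro J hJ v hctr' h10 hmem' hV'
          exact reaches_hornerEntry (hru.of_eq (by norm_num) hctr' hmem')
            (by rw [hctr' 7 (by norm_num), htu.ctr 7 (by norm_num), h7])
            (by rw [hctr' 8 (by norm_num), hu8]) (by rw [hctr' 9 (by norm_num), hu9]) h10 hV')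
      rw [hru.m_succ] at hloop
      refine ⟨?_, ?_⟩
      · simpa [flatMap_const_nil] using (htu.mono (b' := 7) (by norm_num) le_rfl).trans
          (hloop.1.mono (by norm_num) le_rfl)
      -- With `J = m + 1` every column `j ≤ m` of the new row is covered, so the invariant of the
      -- outer loop resumes with an empty partial row.
      · refine ⟨hloop.2.row_zero, hloop.2.col_zero, fun t j htj hj => hloop.2.succ t j ?_ hj⟩
        omega)
  rw [h.l_succ, flatMap_const_nil] at key
  refine ⟨key.1, key.2.row_zero, key.2.col_zero, fun t ht j hj =>
    key.2.succ t j (Or.inl (by omega)) hj⟩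

/-- Adding a cell of array `9`, which is always zero, serves as the copy instruction. The column
shift is that of the Horner table. -/
theorem reaches_copyProgram {inp : Input} {s : Config} (h : IsReady inp s) :
    Reaches 7 s (copyProgram.exec inp s) [] (1 + (inp.m + 1) * (2 + 1)) ∧
      ∀ k ≤ inp.m, (copyProgram.exec inp s).mem 1 0 k = s.mem 0 (inp.l + 1) (k + 1) := by
  have key := Reaches.loop (inp := inp) (b := 7) (x := 7) (y := 5) (s := s) (L := fun _ => [])
    (T := 2) (p := .block (.add 8 7 3) [.radd ⟨1, 6, 7⟩ ⟨0, 4, 8⟩ ⟨9, 6, 6⟩]) le_rfl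
    (fun i V => V 0 = s.mem 0 ∧ ∀ k < i, V 1 0 k = s.mem 0 (inp.l + 1) (k + 1))
    ⟨rfl, by omega⟩ (by
      intro i hi t hctr h7 hmem hV
      have ht := h.of_eq le_rfl hctr hmem
      have h3 := ht.one
      have h4 := ht.l_succ
      have h6 := ht.zero
      have h9 := ht.mem_zero
      refine ⟨⟨fun x hx => ?_, ?_, ?_, ?_⟩, ?_, fun k hk => ?_⟩ <;>
        simp [Program.exec, Config.tick, Config.setCtr, Config.put, Config.get,
          Function.update_apply, h3, h4, h6, h7, h9, hV.1]
      · omega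
      · rfl
      · split_ifs with hk'
        · rw [hk']
        · exact hV.2 k (by omega))
  rw [h.m_succ, flatMap_const_nil] at key
  exact ⟨key.1, fun k hk => key.2.2 k (by omega)⟩

theorem reaches_rotationEntry {inp : Input} {t : Config} (h : IsReady inp t) {τ k : ℕ}
    (h7 : t.ctr 7 = τ) (h8 : t.ctr 8 = τ + 1) (h9 : t.ctr 9 = k) :
    Reaches 9 t (rotationEntry.exec inp t) [] 5 ∧
      ∀ r j, (rotationEntry.exec inp t).mem 1 r j = if r = τ + 1 ∧ j = k then
        √(t.mem 1 τ k ^ 2 + t.mem 1 τ (k + 1) ^ 2) else t.mem 1 r j := by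
  have h6 := h.zero
  have h3 := h.one
  refine ⟨⟨fun x hx => ?_, ?_, ?_, ?_⟩, fun r j => ?_⟩ <;>
    simp [rotationEntry, Program.exec, Config.tick, Config.setCtr, Config.put, Config.get,
      Function.update_apply, h3, h6, h7, h8, h9, sq]
  omega

/-- Each row is filled for all `k < m`, although only the entries with `k + t ≤ m` are meaningful
norms; the recurrence holds literally at the others too. Writing row `τ + 1` does not disturb the
rows it is computed from. -/
theorem reaches_rotationProgram {inp : Input} {s : Config} (h : IsReady inp s) {w : ℕ → ℝ}
    (hw : ∀ k ≤ inp.m, s.mem 1 0 k = w k) :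
    Reaches 7 s (rotationProgram.exec inp s) []
        (1 + inp.m * (1 + (1 + inp.m * (5 + 1)) + 1)) ∧
      IsRotationTable inp.m w ((rotationProgram.exec inp s).mem 1) := by
  have key := Reaches.loop (inp := inp) (b := 7) (x := 7) (y := 1) (s := s) (L := fun _ => [])
    (T := 1 + (1 + inp.m * (5 + 1)))
    (p := .block (.add 8 7 3) [.loop 9 1 rotationEntry]) le_rfl
    (fun τ V => (∀ k ≤ inp.m, V 1 0 k = w k) ∧
      ∀ t < τ, ∀ k < inp.m, V 1 (t + 1) k = √(V 1 t k ^ 2 + V 1 t (k + 1) ^ 2))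
    ⟨hw, by omega⟩ (by
      intro τ hτ t hctr h7 hmem hV
      have ht := h.of_eq le_rfl hctr hmem
      rw [Program.exec_block_cons, Program.exec_block_nil]
      set u := (Program.add 8 7 3).exec inp t with hu
      have htu : Reaches 8 t u [] 1 := by
        refine ⟨fun x hx => ?_, ?_, ?_, ?_⟩ <;>
          simp [hu, Program.exec, Config.tick, Config.setCtr, Function.update_apply]
        omega
      have hu8 : u.ctr 8 = τ + 1 := by
        simp [hu, Program.exec, Config.tick, Config.setCtr, h7, ht.one]
      have hru := ht.of_eq (by norm_num) htu.ctr htu.zero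
      have hloop := Reaches.loop (inp := inp) (b := 9) (x := 9) (y := 1) (s := u)
        (L := fun _ => []) (T := 5) (p := rotationEntry) le_rfl
        (fun j V => (∀ k ≤ inp.m, V 1 0 k = w k) ∧
          ∀ t k, t < τ ∨ t = τ ∧ k < j → k < inp.m →
            V 1 (t + 1) k = √(V 1 t k ^ 2 + V 1 t (k + 1) ^ 2))
        ⟨hV.1, fun t k htk hk => hV.2 t (by omega) k hk⟩ (by
          intro j hj v hctr' h9 hmem' hV'
          obtain ⟨hv, hv'⟩ := reaches_rotationEntry (hru.of_eq (by norm_num) hctr' hmem')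
            (by rw [hctr' 7 (by norm_num), htu.ctr 7 (by norm_num), h7])
            (by rw [hctr' 8 (by norm_num), hu8]) h9
          refine ⟨hv, fun k hk => ?_, fun t k htk hk => ?_⟩
          · rw [hv', if_neg (by omega), hV'.1 k hk]
          · rw [hv' t k, if_neg (by omega), hv' t (k + 1), if_neg (by omega), hv']
            split_ifs with h1
            · obtain ⟨rfl, rfl⟩ : t = τ ∧ k = j := by omega
              rfl
            · exact hV'.2 t k (by omega) hk)
      rw [hru.m] at hloop
      refine ⟨?_, hloop.2.1, fun t ht k hk => hloop.2.2 t k (by omega) hk⟩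
      simpa [flatMap_const_nil] using (htu.mono (b' := 7) (by norm_num) le_rfl).trans
        (hloop.1.mono (by norm_num) le_rfl))
  rw [h.m, flatMap_const_nil] at key
  exact ⟨key.1, key.2.1, key.2.2⟩

/-! ### The quantum part of the program -/

/-- From `s` the program `p` applies the quantum steps `L` in at most `T` steps of time, without
changing the counters below `b` and the real memory. -/
structure Emits (inp : Input) (b : ℕ) (p : Program) (s : Config)
    (L : List (QStep (Register × ℕ) ℝ)) (T : ℕ) : Prop where
  reaches : Reaches b s (p.exec inp s) L T
  mem : (p.exec inp s).mem = s.mem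

section

variable {inp : Input}

theorem Emits.mono {b b' T T' : ℕ} {p : Program} {s : Config}
    {L : List (QStep (Register × ℕ) ℝ)} (h : Emits inp b p s L T) (hb : b' ≤ b) (hT : T ≤ T') :
    Emits inp b' p s L T' :=
  ⟨h.reaches.mono hb hT, h.mem⟩

theorem Emits.seq {b T T' : ℕ} {p q : Program} {s : Config}
    {L L' : List (QStep (Register × ℕ) ℝ)} (h : Emits inp b p s L T)
    (h' : Emits inp b q (p.exec inp s) L' T') : Emits inp b (.seq p q) s (L ++ L') (T + T') :=
  ⟨h.reaches.trans h'.reaches, h'.mem.trans h.mem⟩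

theorem Emits.loop {b x y T : ℕ} {p : Program} {s : Config}
    {L : ℕ → List (QStep (Register × ℕ) ℝ)} (hb : b ≤ x)
    (h : ∀ i < s.ctr y, ∀ t : Config, (∀ z < b, t.ctr z = s.ctr z) → t.ctr x = i →
      t.mem = s.mem → Emits inp b p t (L i) T) :
    Emits inp b (.loop x y p) s ((List.range (s.ctr y)).flatMap L) (1 + s.ctr y * (T + 1)) := by
  have := Reaches.loop (inp := inp) (p := p) (y := y) (T := T) (L := L) hb
    (fun _ V => V = s.mem) rfl fun i hi t hctr hx _ hmem =>
      ⟨(h i hi t hctr hx hmem).reaches, (h i hi t hctr hx hmem).mem.trans hmem⟩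
  exact ⟨this.1, this.2⟩

/-- Rotation and counting, for the qubit in counter `7` and the loop index in counter `9`; the row
of the table of rotation parameters is in counter `8`. -/
def rotateEntry : Program :=
  .block (.sub 10 1 9)
    [.sub 11 10 3,
      .quantum (.gate (.ctrl (.anc, 11) (.rot ⟨1, 8, 11⟩ ⟨1, 8, 10⟩) (.A, 7))),
      .quantum (.gate (.ctrl₂ (.A, 7) (.anc, 11) .X (.anc, 10))),
      .quantum (.gate (.ctrl₂ (.A, 7) (.anc, 10) .X (.anc, 11)))]

/-- Rotation and counting for all qubits of register `A`. -/
def rotateProgram : Program :=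
  .loop 7 1 (.block (.sub 8 1 7) [.sub 8 8 3, .loop 9 1 rotateEntry])

/-- One gate pair of the uncomputation of the counter. -/
def uncountEntry : Program :=
  .block (.add 9 8 3)
    [.quantum (.gate (.ctrl₂ (.A, 7) (.anc, 9) .X (.anc, 8))),
      .quantum (.gate (.ctrl₂ (.A, 7) (.anc, 8) .X (.anc, 9)))]

/-- Uncomputation of the counter. -/
def uncountProgram : Program := .loop 7 1 (.loop 8 1 uncountEntry)

/-- Preparation of the pilot state. -/
def pilotProgram : Program :=
  .seq (.seq (.seq
    (.block (.quantum (.gate (.single .X (.anc, 6))))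
      [.quantum (.gate (.single (.rot ⟨1, 1, 6⟩ ⟨9, 6, 6⟩) (.anc, 6)))])
    rotateProgram) uncountProgram)
    (.quantum (.gate (.single .X (.anc, 6))))

/-- Preparation of the maximally entangled state. -/
def bellPreparationProgram : Program :=
  .loop 7 0 (.block (.quantum (.gate (.single .H (.B, 7))))
    [.quantum (.gate (.cx (.B, 7) (.C, 7)))])

/-- The sign phases. -/
def signPhasesProgram : Program :=
  .loop 7 1 (.block (.readSign 8 7)
    [.ifZero 8 (.set 8 0) (.quantum (.gate (.single .Z (.A, 7))))])

/-- One controlled Pauli, with the term in counter `7` and the qubit in counter `8`. -/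
def controlledPauliEntry : Program :=
  .block (.readPauli 9 7 8)
    [.ifZero 9 (.set 9 0) (.block (.sub 9 9 3)
      [.ifZero 9 (.quantum (.gate (.ctrl (.A, 7) .X (.B, 8)))) (.block (.sub 9 9 3)
        [.ifZero 9 (.quantum (.gate (.ctrl (.A, 7) .Y (.B, 8))))
          (.quantum (.gate (.ctrl (.A, 7) .Z (.B, 8))))])])]

/-- The controlled Pauli strings. -/
def controlledPaulisProgram : Program := .loop 7 1 (.loop 8 0 controlledPauliEntry)

/-- The coherent Bell measurement. -/
def bellMeasurementProgram : Program :=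
  .loop 7 0 (.block (.quantum (.gate (.cx (.B, 7) (.C, 7))))
    [.quantum (.gate (.single .H (.B, 7))), .quantum (.gate (.cx (.B, 7) (.C, 7))),
      .quantum (.gate (.cx (.C, 7) (.B, 7))), .quantum (.gate (.cx (.B, 7) (.C, 7)))])

/-- The inverse of the coherent Bell measurement. -/
def bellMeasurementInverseProgram : Program :=
  .loop 7 0 (.block (.sub 8 0 7)
    [.sub 8 8 3, .quantum (.gate (.cx (.B, 8) (.C, 8))), .quantum (.gate (.cx (.C, 8) (.B, 8))),
      .quantum (.gate (.cx (.B, 8) (.C, 8))), .quantum (.gate (.single .H (.B, 8))),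
      .quantum (.gate (.cx (.B, 8) (.C, 8)))])

/-- The addressed form of `rotateAndCount`. -/
def rotateGates (m : ℕ) (g : ℕ → ℕ → ℝ) (i k : ℕ) : List (QStep (Register × ℕ) ℝ) :=
  [.gate (.ctrl (.anc, k) (.rot (g (m - i - 1) k) (g (m - i - 1) (k + 1))) (.A, i)),
    .gate (.ctrl₂ (.A, i) (.anc, k) .X (.anc, k + 1)),
    .gate (.ctrl₂ (.A, i) (.anc, k + 1) .X (.anc, k))]

/-- The addressed form of `uncount`. -/
def uncountGates (i k : ℕ) : List (QStep (Register × ℕ) ℝ) :=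
  [.gate (.ctrl₂ (.A, i) (.anc, k + 1) .X (.anc, k)),
    .gate (.ctrl₂ (.A, i) (.anc, k) .X (.anc, k + 1))]

/-- The addressed form of `pilotCircuit`. -/
def pilotGates (m : ℕ) (g : ℕ → ℕ → ℝ) : List (QStep (Register × ℕ) ℝ) :=
  [.gate (.single .X (.anc, 0)), .gate (.single (.rot (g m 0) 0) (.anc, 0))] ++
    ((List.range m).flatMap fun i => (List.range m).flatMap fun s =>
      rotateGates m g i (m - (s + 1))) ++
    ((List.range m).flatMap fun i => (List.range m).flatMap fun k => uncountGates i k) ++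
    [.gate (.single .X (.anc, 0))]

/-- The addressed form of `bellPreparation`. -/
def bellPreparationGates (n : ℕ) : List (QStep (Register × ℕ) ℝ) :=
  (List.range n).flatMap fun j => [.gate (.single .H (.B, j)), .gate (.cx (.B, j) (.C, j))]

/-- The addressed form of `signPhases`. -/
def signPhasesGates (inp : Input) : List (QStep (Register × ℕ) ℝ) :=
  (List.range inp.m).flatMap fun i =>
    if inp.sign i = 0 then [] else [.gate (.single .Z (.A, i))]

/-- The addressed form of `controlledPauli`. -/
def controlledPauliGates (i j : ℕ) : ℕ → List (QStep (Register × ℕ) ℝ)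
  | 0 => []
  | 1 => [.gate (.ctrl (.A, i) .X (.B, j))]
  | 2 => [.gate (.ctrl (.A, i) .Y (.B, j))]
  | _ + 3 => [.gate (.ctrl (.A, i) .Z (.B, j))]

/-- The addressed form of `controlledPaulis`. -/
def controlledPaulisGates (inp : Input) : List (QStep (Register × ℕ) ℝ) :=
  (List.range inp.m).flatMap fun i => (List.range inp.n).flatMap fun j =>
    controlledPauliGates i j (inp.pauli i j)

/-- The addressed form of the Bell measurement of one pair. -/
def bellMeasurementPair (j : ℕ) : List (QStep (Register × ℕ) ℝ) :=
  [.gate (.cx (.B, j) (.C, j)), .gate (.single .H (.B, j)),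
    .gate (.cx (.B, j) (.C, j)), .gate (.cx (.C, j) (.B, j)), .gate (.cx (.B, j) (.C, j))]

theorem emits_rotateEntry {t : Config} (h : IsReady inp t) {i s : ℕ} (hs : s < inp.m)
    (h7 : t.ctr 7 = i) (h8 : t.ctr 8 = inp.m - i - 1) (h9 : t.ctr 9 = s) :
    Emits inp 9 rotateEntry t (rotateGates inp.m (t.mem 1) i (inp.m - (s + 1))) 5 := by
  have h1 := h.m
  have h3 := h.one
  -- The loop index `s` counts upwards while `k = m - (s + 1)` counts downwards; counters `11` and
  -- `10` hold `k` and `k + 1`, the latter because `s < m`.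
  have hk : inp.m - s - 1 = inp.m - (s + 1) := by omega
  have hk' : inp.m - s = inp.m - (s + 1) + 1 := by omega
  refine ⟨⟨fun x hx => ?_, ?_, ?_, ?_⟩, ?_⟩ <;>
    simp [rotateEntry, Program.exec, Config.tick, Config.setCtr, Config.get, rotateGates,
      QStep.map, Gate.map, OneQubit.map, Function.update_apply, h1, h3, h7, h8, h9, hk]
  · split_ifs <;> omega
  · rw [hk']; simp

theorem emits_rotateProgram {s : Config} (h : IsReady inp s) :
    Emits inp 7 rotateProgram s ((List.range inp.m).flatMap fun i =>
        (List.range inp.m).flatMap fun k => rotateGates inp.m (s.mem 1) i (inp.m - (k + 1)))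
      (1 + inp.m * (2 + (1 + inp.m * (5 + 1)) + 1)) := by
  have key := Emits.loop (inp := inp) (b := 7) (x := 7) (y := 1) (s := s)
    (L := fun i => (List.range inp.m).flatMap fun k =>
      rotateGates inp.m (s.mem 1) i (inp.m - (k + 1)))
    (T := 2 + (1 + inp.m * (5 + 1)))
    (p := .block (.sub 8 1 7) [.sub 8 8 3, .loop 9 1 rotateEntry]) le_rfl (by
      intro i hi t hctr h7 hmem
      have ht := h.of_eq le_rfl hctr (congrFun hmem 9)
      set u := (Program.sub 8 8 3).exec inp ((Program.sub 8 1 7).exec inp t) with hu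
      have htu : Reaches 8 t u [] 2 := by
        refine ⟨fun x hx => ?_, ?_, ?_, ?_⟩ <;>
          simp [hu, Program.exec, Config.tick, Config.setCtr, Function.update_apply]
        omega
      have hmem_u : u.mem = t.mem := rfl
      have hu8 : u.ctr 8 = inp.m - i - 1 := by
        simp [hu, Program.exec, Config.tick, Config.setCtr, h7, ht.one, ht.m]
      have hru := ht.of_eq (by norm_num) htu.ctr htu.zero
      have hloop := Emits.loop (inp := inp) (b := 9) (x := 9) (y := 1) (s := u)
        (L := fun k => rotateGates inp.m (s.mem 1) i (inp.m - (k + 1))) (T := 5)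
        (p := rotateEntry) le_rfl (by
          intro k hk v hctr' h9 hmem'
          have := emits_rotateEntry (hru.of_eq (by norm_num) hctr' (congrFun hmem' 9))
            (hru.m ▸ hk)
            (by rw [hctr' 7 (by norm_num), htu.ctr 7 (by norm_num), h7])
            (by rw [hctr' 8 (by norm_num), hu8]) h9
          rwa [hmem', hmem_u, hmem] at this)
      rw [hru.m] at hloop
      refine ⟨?_, hloop.mem.trans hmem_u⟩
      simpa using (htu.mono (b' := 7) (by norm_num) le_rfl).trans
        (hloop.reaches.mono (by norm_num) le_rfl))
  rw [h.m] at key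
  exact key

theorem emits_uncountProgram {s : Config} (h : IsReady inp s) :
    Emits inp 7 uncountProgram s ((List.range inp.m).flatMap fun i =>
        (List.range inp.m).flatMap fun k => uncountGates i k)
      (1 + inp.m * (1 + inp.m * (3 + 1) + 1)) := by
  have key := Emits.loop (inp := inp) (b := 7) (x := 7) (y := 1) (s := s)
    (L := fun i => (List.range inp.m).flatMap fun k => uncountGates i k)
    (T := 1 + inp.m * (3 + 1)) (p := .loop 8 1 uncountEntry) le_rfl (by
      intro i hi t hctr h7 hmem
      have ht := h.of_eq le_rfl hctr (congrFun hmem 9)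
      have hloop := Emits.loop (inp := inp) (b := 8) (x := 8) (y := 1) (s := t)
        (L := fun k => uncountGates i k) (T := 3) (p := uncountEntry) le_rfl (by
          intro k hk v hctr' h8 hmem'
          have h7' : v.ctr 7 = i := (hctr' 7 (by norm_num)).trans h7
          have h3 := (ht.of_eq (by norm_num) hctr' (congrFun hmem' 9)).one
          refine ⟨⟨fun x hx => ?_, ?_, ?_, ?_⟩, ?_⟩ <;>
            simp [uncountEntry, Program.exec, Config.tick, Config.setCtr, uncountGates,
              QStep.map, Gate.map, OneQubit.map, Function.update_apply, h3, h7', h8]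
          omega)
      rw [ht.m] at hloop
      exact hloop.mono (by norm_num) le_rfl)
  rw [h.m] at key
  exact key

theorem emits_pilotProgram {s : Config} (h : IsReady inp s) :
    Emits inp 7 pilotProgram s (pilotGates inp.m (s.mem 1))
      (2 + (1 + inp.m * (2 + (1 + inp.m * (5 + 1)) + 1)) +
        (1 + inp.m * (1 + inp.m * (3 + 1) + 1)) + 1) := by
  have h1 : Emits inp 7 (.block (.quantum (.gate (.single .X (.anc, 6))))
      [.quantum (.gate (.single (.rot ⟨1, 1, 6⟩ ⟨9, 6, 6⟩) (.anc, 6)))]) s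
      [.gate (.single .X (.anc, 0)), .gate (.single (.rot (s.mem 1 inp.m 0) 0) (.anc, 0))] 2 := by
    refine ⟨⟨fun x hx => ?_, ?_, ?_, ?_⟩, ?_⟩ <;>
      simp [Program.exec, Config.tick, Config.get, QStep.map, Gate.map, OneQubit.map, h.zero, h.m,
        h.mem_zero]
  have hr1 := h.of_reaches h1.reaches
  have h2 := emits_rotateProgram hr1
  rw [h1.mem] at h2
  have h12 := h1.seq h2
  have hr2 := h.of_reaches h12.reaches
  have h123 := h12.seq (emits_uncountProgram hr2)
  have hr3 := h.of_reaches h123.reaches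
  have h4 : ∀ t : Config, t.ctr 6 = 0 → Emits inp 7 (.quantum (.gate (.single .X (.anc, 6)))) t
      [.gate (.single .X (.anc, 0))] 1 := by
    intro t ht
    refine ⟨⟨fun x hx => ?_, ?_, ?_, ?_⟩, ?_⟩ <;>
      simp [Program.exec, Config.tick, QStep.map, Gate.map, OneQubit.map, ht]
  exact h123.seq (h4 _ hr3.zero)

theorem emits_bellPreparationProgram {s : Config} (h : IsReady inp s) :
    Emits inp 7 bellPreparationProgram s (bellPreparationGates inp.n)
      (1 + inp.n * (2 + 1)) := by
  have key := Emits.loop (inp := inp) (b := 7) (x := 7) (y := 0) (s := s)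
    (L := fun j => [.gate (.single .H (.B, j)), .gate (.cx (.B, j) (.C, j))]) (T := 2)
    (p := .block (.quantum (.gate (.single .H (.B, 7))))
      [.quantum (.gate (.cx (.B, 7) (.C, 7)))]) le_rfl (by
      intro i hi t hctr h7 hmem
      refine ⟨⟨fun x hx => ?_, ?_, ?_, ?_⟩, ?_⟩ <;>
        simp [Program.exec, Config.tick, QStep.map, Gate.map, OneQubit.map, Gate.cx, h7])
  rw [h.n] at key
  exact key

theorem emits_signPhasesProgram {s : Config} (h : IsReady inp s) :
    Emits inp 7 signPhasesProgram s (signPhasesGates inp) (1 + inp.m * (3 + 1)) := by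
  have key := Emits.loop (inp := inp) (b := 7) (x := 7) (y := 1) (s := s)
    (L := fun i => if inp.sign i = 0 then [] else [.gate (.single .Z (.A, i))]) (T := 3)
    (p := .block (.readSign 8 7)
      [.ifZero 8 (.set 8 0) (.quantum (.gate (.single .Z (.A, 7))))]) le_rfl (by
      intro i hi t hctr h7 hmem
      by_cases hsign : inp.sign i = 0
      · refine ⟨⟨fun x hx => ?_, ?_, ?_, ?_⟩, ?_⟩ <;>
          simp [Program.exec, Config.tick, Config.setCtr, Function.update_apply, h7, hsign]
        omega
      · refine ⟨⟨fun x hx => ?_, ?_, ?_, ?_⟩, ?_⟩ <;>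
          simp [Program.exec, Config.tick, Config.setCtr, Function.update_apply, QStep.map,
            Gate.map, OneQubit.map, h7, hsign]
        omega)
  rw [h.m] at key
  exact key

theorem emits_controlledPauliEntry {t : Config} (h : IsReady inp t) {i j : ℕ}
    (h7 : t.ctr 7 = i) (h8 : t.ctr 8 = j) :
    Emits inp 8 controlledPauliEntry t (controlledPauliGates i j (inp.pauli i j)) 7 := by
  have h3 := h.one
  -- The program decrements the code until it is zero; the longest branches, for `Y` and `Z`, take
  -- the seven steps. Every code from `3` on ends in the last branch.
  match hσ : inp.pauli i j with
  | 0 | 1 | 2 | k + 3 =>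
    refine ⟨⟨fun x hx => ?_, ?_, ?_, ?_⟩, ?_⟩ <;>
      simp [controlledPauliEntry, Program.exec, Config.tick, Config.setCtr, Function.update_apply,
        QStep.map, Gate.map, OneQubit.map, controlledPauliGates, h3, h7, h8, hσ]
    try omega

theorem emits_controlledPaulisProgram {s : Config} (h : IsReady inp s) :
    Emits inp 7 controlledPaulisProgram s (controlledPaulisGates inp)
      (1 + inp.m * (1 + inp.n * (7 + 1) + 1)) := by
  have key := Emits.loop (inp := inp) (b := 7) (x := 7) (y := 1) (s := s)
    (L := fun i => (List.range inp.n).flatMap fun j => controlledPauliGates i j (inp.pauli i j))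
    (T := 1 + inp.n * (7 + 1)) (p := .loop 8 0 controlledPauliEntry) le_rfl (by
      intro i hi t hctr h7 hmem
      have ht := h.of_eq le_rfl hctr (congrFun hmem 9)
      have hloop := Emits.loop (inp := inp) (b := 8) (x := 8) (y := 0) (s := t)
        (L := fun j => controlledPauliGates i j (inp.pauli i j)) (T := 7)
        (p := controlledPauliEntry) le_rfl fun j hj v hctr' h8 hmem' =>
          emits_controlledPauliEntry (ht.of_eq (by norm_num) hctr' (congrFun hmem' 9))
            ((hctr' 7 (by norm_num)).trans h7) h8
      rw [ht.n] at hloop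
      exact hloop.mono (by norm_num) le_rfl)
  rw [h.m] at key
  exact key

theorem emits_bellMeasurementProgram {s : Config} (h : IsReady inp s) :
    Emits inp 7 bellMeasurementProgram s ((List.range inp.n).flatMap bellMeasurementPair)
      (1 + inp.n * (5 + 1)) := by
  have key := Emits.loop (inp := inp) (b := 7) (x := 7) (y := 0) (s := s)
    (L := bellMeasurementPair) (T := 5)
    (p := .block (.quantum (.gate (.cx (.B, 7) (.C, 7))))
      [.quantum (.gate (.single .H (.B, 7))), .quantum (.gate (.cx (.B, 7) (.C, 7))),
        .quantum (.gate (.cx (.C, 7) (.B, 7))), .quantum (.gate (.cx (.B, 7) (.C, 7)))]) le_rfl (by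
      intro i hi t hctr h7 hmem
      refine ⟨⟨fun x hx => ?_, ?_, ?_, ?_⟩, ?_⟩ <;>
        simp [Program.exec, Config.tick, QStep.map, Gate.map, OneQubit.map, Gate.cx,
          bellMeasurementPair, h7])
  rw [h.n] at key
  exact key

/-- Pairs are visited from the last to the first, so that the emitted list is literally the reversed
circuit. -/
theorem emits_bellMeasurementInverseProgram {s : Config} (h : IsReady inp s) :
    Emits inp 7 bellMeasurementInverseProgram s
      ((List.range inp.n).flatMap fun j => (bellMeasurementPair (inp.n - (j + 1))).reverse)
      (1 + inp.n * (7 + 1)) := by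
  have key := Emits.loop (inp := inp) (b := 7) (x := 7) (y := 0) (s := s)
    (L := fun j => (bellMeasurementPair (inp.n - (j + 1))).reverse) (T := 7)
    (p := .block (.sub 8 0 7)
      [.sub 8 8 3, .quantum (.gate (.cx (.B, 8) (.C, 8))),
        .quantum (.gate (.cx (.C, 8) (.B, 8))), .quantum (.gate (.cx (.B, 8) (.C, 8))),
        .quantum (.gate (.single .H (.B, 8))), .quantum (.gate (.cx (.B, 8) (.C, 8)))]) le_rfl (by
      intro i hi t hctr h7 hmem
      have ht := h.of_eq le_rfl hctr (congrFun hmem 9)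
      refine ⟨⟨fun x hx => ?_, ?_, ?_, ?_⟩, ?_⟩ <;>
        simp [Program.exec, Config.tick, Config.setCtr, Function.update_apply, QStep.map,
          Gate.map, OneQubit.map, Gate.cx, bellMeasurementPair, h7, ht.n, ht.one, Nat.sub_sub]
      omega)
  rw [h.n] at key
  exact key

end

/-! ### The circuit of the program -/

section

variable {n m : ℕ}

theorem flatMap_finRange {α : Type*} {N : ℕ} {f : Fin N → List α} {g : ℕ → List α}
    (h : ∀ i : Fin N, f i = g i) : (List.finRange N).flatMap f = (List.range N).flatMap g := by
  rw [← List.map_coe_finRange_eq_range, List.flatMap_map]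
  congr 1
  funext i
  exact h i

theorem map_pilotCircuit (g : ℕ → ℕ → ℝ) :
    ((pilotCircuit n m g).map .gate).map (QStep.map Wire.address id) = pilotGates m g := by
  simp only [pilotCircuit, pilotGates, List.map_append, List.map_flatMap]
  congr 1
  congr 1
  · congr 1
    refine flatMap_finRange fun i => flatMap_finRange fun s => ?_
    simp [rotateAndCount, rotateGates, QStep.map, Gate.map, OneQubit.map, Wire.address, Wire.anc,
      Wire.A, Fin.val_rev]
  · refine flatMap_finRange fun i => flatMap_finRange fun k => ?_
    simp [uncount, uncountGates, QStep.map, Gate.map, OneQubit.map, Wire.address, Wire.anc,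
      Wire.A]

theorem map_bellPreparation {a : ℕ} :
    ((bellPreparation (n := n) (m := m) (a := a)).map .gate).map (QStep.map Wire.address id) =
      bellPreparationGates n := by
  simp only [bellPreparation, bellPreparationGates, List.map_flatMap]
  exact flatMap_finRange fun j => rfl

theorem map_signPhases {a : ℕ} (H : PauliHamiltonian n m) (l : ℕ) (p : Polynomial ℝ) :
    ((signPhases (a := a) H).map .gate).map (QStep.map Wire.address id) =
      signPhasesGates (.of H l p) := by
  simp only [signPhases, signPhasesGates, List.map_flatMap]
  refine flatMap_finRange fun i => ?_
  by_cases hv : H.v i = -1 <;> simp [Input.of, hv, QStep.map, Gate.map, OneQubit.map,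
    Wire.address, Wire.A]

theorem map_controlledPaulis {a : ℕ} (H : PauliHamiltonian n m) (l : ℕ) (p : Polynomial ℝ) :
    ((controlledPaulis (a := a) H).map .gate).map (QStep.map Wire.address id) =
      controlledPaulisGates (.of H l p) := by
  simp only [controlledPaulis, controlledPaulisGates, List.map_flatMap]
  refine flatMap_finRange fun i => flatMap_finRange fun j => ?_
  cases hσ : H.P i j <;> simp [Input.of, hσ, controlledPauli, Pauli.code, controlledPauliGates,
    QStep.map, Gate.map, OneQubit.map, Wire.address, Wire.A, Wire.B]

theorem map_bellMeasurement {a : ℕ} :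
    ((bellMeasurement (n := n) (m := m) (a := a)).map .gate).map (QStep.map Wire.address id) =
      (List.range n).flatMap bellMeasurementPair := by
  simp only [bellMeasurement, List.map_flatMap]
  exact flatMap_finRange fun j => rfl

theorem map_bellMeasurement_reverse {a : ℕ} :
    ((bellMeasurement (n := n) (m := m) (a := a)).reverse.map .gate).map
        (QStep.map Wire.address id) =
      (List.range n).flatMap fun j => (bellMeasurementPair (n - (j + 1))).reverse := by
  simp only [bellMeasurement, List.reverse_flatMap, List.finRange_reverse, List.map_flatMap,
    List.flatMap_map]
  refine flatMap_finRange fun j => ?_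
  rw [← Fin.val_rev]
  rfl

/-- Hamiltonian decoded quantum interferometry as a program. -/
def hdqiProgram : Program :=
  .block initProgram
    [hornerProgram, copyProgram, rotationProgram, .seq (.seq (.seq (.seq (.seq (.seq
      pilotProgram bellPreparationProgram) signPhasesProgram) controlledPaulisProgram)
      bellMeasurementProgram) (.quantum .oracle)) bellMeasurementInverseProgram]

/-- A bound for the running time of the program. -/
def timeBound (n m l : ℕ) : ℕ :=
  3 + (1 + (l + 1) * (2 + (1 + (m + 1) * (11 + 1)) + 1)) + (1 + (m + 1) * (2 + 1)) +
    (1 + m * (1 + (1 + m * (5 + 1)) + 1)) +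
    (2 + (1 + m * (2 + (1 + m * (5 + 1)) + 1)) + (1 + m * (1 + m * (3 + 1) + 1)) + 1 +
      (1 + n * (2 + 1)) + (1 + m * (3 + 1)) + (1 + m * (1 + n * (7 + 1) + 1)) +
      (1 + n * (5 + 1)) + 1 + (1 + n * (7 + 1)))

theorem timeBound_mono {n m m' l l' : ℕ} (hm : m ≤ m') (hl : l ≤ l') :
    timeBound n m l ≤ timeBound n m' l' := by
  unfold timeBound
  gcongr

/-- The circuit applied by the program, in terms of the table of rotation parameters. -/
def hdqiGates (inp : Input) (g : ℕ → ℕ → ℝ) : List (QStep (Register × ℕ) ℝ) :=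
  pilotGates inp.m g ++ bellPreparationGates inp.n ++ signPhasesGates inp ++
    controlledPaulisGates inp ++ (List.range inp.n).flatMap bellMeasurementPair ++ [.oracle] ++
    (List.range inp.n).flatMap fun j => (bellMeasurementPair (inp.n - (j + 1))).reverse

theorem hdqiProgram_run (inp : Input) :
    ∃ V g : ℕ → ℕ → ℝ, IsHornerTable inp.m inp.l inp.coeff V ∧
      IsRotationTable inp.m (fun k => V (inp.l + 1) (k + 1)) g ∧
      (hdqiProgram.run inp).circuit = hdqiGates inp g ∧
      (hdqiProgram.run inp).time ≤ timeBound inp.n inp.m inp.l := by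
  rw [Program.run]
  set s₀ : Config :=
    { ctr := fun x => if x = 0 then inp.n else if x = 1 then inp.m else if x = 2 then inp.l else 0
      mem := fun _ _ _ => 0
      circuit := []
      time := 0 } with hs₀
  simp only [hdqiProgram, Program.exec_block_cons, Program.exec_block_nil]
  set s₁ := initProgram.exec inp s₀ with hs₁
  have hr₁ : IsReady inp s₁ := by
    constructor <;> simp [hs₁, hs₀, initProgram, Program.exec, Config.tick, Config.setCtr]
    rfl
  have hmem₁ : s₁.mem 0 = 0 := rfl
  have hcircuit₁ : s₁.circuit = [] := rfl
  have htime₁ : s₁.time = 3 := rfl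
  clear_value s₁
  obtain ⟨h₂, hV⟩ := reaches_hornerProgram hr₁ hmem₁
  have hr₂ := hr₁.of_reaches h₂
  set s₂ := hornerProgram.exec inp s₁
  obtain ⟨h₃, hcopy⟩ := reaches_copyProgram hr₂
  have hr₃ := hr₂.of_reaches h₃
  set s₃ := copyProgram.exec inp s₂
  obtain ⟨h₄, hg⟩ := reaches_rotationProgram hr₃ hcopy
  have hr₄ := hr₃.of_reaches h₄
  set s₄ := rotationProgram.exec inp s₃
  have q₁ := emits_pilotProgram hr₄
  have q₂ := q₁.seq (emits_bellPreparationProgram (hr₄.of_reaches q₁.reaches))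
  have q₃ := q₂.seq (emits_signPhasesProgram (hr₄.of_reaches q₂.reaches))
  have q₄ := q₃.seq (emits_controlledPaulisProgram (hr₄.of_reaches q₃.reaches))
  have q₅ := q₄.seq (emits_bellMeasurementProgram (hr₄.of_reaches q₄.reaches))
  have horacle : ∀ t : Config, Emits inp 7 (.quantum .oracle) t [.oracle] 1 := fun t =>
    ⟨⟨fun _ _ => rfl, rfl, rfl, le_rfl⟩, rfl⟩
  have q₆ := q₅.seq (horacle _)
  have q₇ := q₆.seq (emits_bellMeasurementInverseProgram (hr₄.of_reaches q₆.reaches))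
  -- The classical phases emit no gates, so the circuit is that of the quantum part, with the
  -- rotation parameters found in array `1` of `s₄`.
  have htotal := ((h₂.trans h₃).trans h₄).trans q₇.reaches
  refine ⟨s₂.mem 0, s₄.mem 1, hV, hg, ?_, ?_⟩
  · rw [htotal.circuit, hcircuit₁]
    rfl
  · refine htotal.time.trans ?_
    rw [htime₁, timeBound]
    simp only [add_assoc]
    exact le_rfl

theorem map_hdqiCircuit (H : PauliHamiltonian n m) (l : ℕ) (p : Polynomial ℝ) (g : ℕ → ℕ → ℝ) :
    (hdqiCircuit H (pilotCircuit n m g)).map (QStep.map Wire.address id) =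
      hdqiGates (.of H l p) g := by
  simp only [hdqiCircuit, List.map_append, map_pilotCircuit, map_bellPreparation,
    map_signPhases H l p, map_controlledPaulis H l p, map_bellMeasurement,
    map_bellMeasurement_reverse]
  rfl

/-- A polynomial bound for the running time and the number of ancillas, if the number of terms is
bounded by the polynomial `q`. -/
theorem exists_polynomial_bound (q : Polynomial ℕ) :
    ∃ r : Polynomial ℕ, ∀ n, r.eval n = timeBound n (q.eval n) (q.eval n) + q.eval n + 1 :=
  ⟨3 + (1 + (q + 1) * (2 + (1 + (q + 1) * (11 + 1)) + 1)) + (1 + (q + 1) * (2 + 1)) +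
    (1 + q * (1 + (1 + q * (5 + 1)) + 1)) +
    (2 + (1 + q * (2 + (1 + q * (5 + 1)) + 1)) + (1 + q * (1 + q * (3 + 1) + 1)) + 1 +
      (1 + .X * (2 + 1)) + (1 + q * (3 + 1)) + (1 + q * (1 + .X * (7 + 1) + 1)) +
      (1 + .X * (5 + 1)) + 1 + (1 + .X * (7 + 1))) + q + 1, fun n => by
    simp only [timeBound, Polynomial.eval_add, Polynomial.eval_mul, Polynomial.eval_one,
      Polynomial.eval_ofNat, Polynomial.eval_X]⟩

end

end HDQI

theorem theorem3p4 :
    ∃ prog : HDQI.Program, ∀ q : Polynomial ℕ, ∃ r : Polynomial ℕ,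
      ∀ (n m l : ℕ) (H : HDQI.PauliHamiltonian n m) (p : Polynomial ℝ),
        m ≤ q.eval n → H.IsCommuting → l ≤ m → p.natDegree ≤ l → p ≠ 0 →
        ∃ (a : ℕ) (pilot : List (HDQI.Gate (HDQI.Wire n m a) ℝ)) (w : ℕ → ℝ),
          -- the total running time and the number of ancillas are polynomial in `n`
          (prog.run (.of H l p)).time ≤ r.eval n ∧
          a ≤ r.eval n ∧
          -- the program executes the algorithm, with a correct preparation of the pilot state
          (prog.run (.of H l p)).circuit =
            (HDQI.hdqiCircuit H pilot).map (HDQI.QStep.map HDQI.Wire.address id) ∧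
          HDQI.IsSymmetricExpansion m l p w ∧
          HDQI.applyGates pilot (HDQI.zeroState (HDQI.Wire n m a)) =
            HDQI.pilotState n m a l w ∧
          -- it makes a single oracle call
          HDQI.oracleCalls (HDQI.hdqiCircuit H pilot) = 1 ∧
          -- with any weight-`l` decoding oracle, register `B` ends in the state `ρ_p(H)`
          ∀ D, H.IsDecodingOracle l D →
            HDQI.reducedB (HDQI.applySteps D (HDQI.hdqiCircuit H pilot)
              (HDQI.zeroState (HDQI.Wire n m a))) = H.polyState p := by
  refine ⟨HDQI.hdqiProgram, fun q => ?_⟩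
  obtain ⟨r, hr⟩ := HDQI.exists_polynomial_bound q
  refine ⟨r, fun n m l H p hm hH hl hp hp0 => ?_⟩
  obtain ⟨V, g, hV, hg, hcircuit, htime⟩ := HDQI.hdqiProgram_run (.of H l p)
  have hw := hV.isSymmetricExpansion hp
  have hpilot := HDQI.applyGates_pilotCircuit (n := n) hg hl
    (fun k hk hkm => hV.eq_zero le_rfl hk hkm) (hw.exists_ne_zero hl hp hp0)
  -- The `m + 1` ancillas are the one-hot counter for weights `0, …, m`, and the weights `w` are the
  -- last row of the Horner table.
  refine ⟨m + 1, HDQI.pilotCircuit n m g, fun k => V (l + 1) (k + 1), ?_, ?_, ?_, hw, hpilot,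
    HDQI.oracleCalls_hdqiCircuit H _, fun D hD => HDQI.reducedB_hdqiCircuit H hH hw hpilot hD⟩
  -- The bound `r` is the running time at `m = l = q(n)`, enlarged by `q(n) + 1` to cover the
  -- ancillas as well.
  · have := HDQI.timeBound_mono (n := n) hm (hl.trans hm)
    rw [hr]
    exact htime.trans (this.trans (by omega))
  · rw [hr]
    omega
  · rw [hcircuit, HDQI.map_hdqiCircuit H l p]
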